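/- \textbf{Setting.} Let $\mathsf X\subset\mathbb R$ and $\mathsf Y\subset\mathbb R^{q}$ be convex, $\mathsf Z=\mathsf X\times\mathsf Y$ with its Borel $\sigma$-algebra, $\Theta\subset\mathbb R^k$ and $\beta\in(0,1)$. For each $\theta\in\Theta$ let $r_\theta:\mathsf Z\to\mathbb R$ (exit payoff) and $c_\theta:\mathsf Y\to\mathbb R$ (flow continuation payoff) be measurable, and let $P_\theta$ be a stochastic kernel on $\mathsf Z$ of the form $P_\theta((x,y),\cdot)=\mathbb F^\theta_y$, i.e. the law of the next state $(x',y')$ depends on $y$ only. Write $c_\theta(x,y):=c_\theta(y)$. Let $(Z_t)_{t\ge 0}$ be the canonical Markov chain with kernel $P_\theta$, $\mathbb E^\theta_z$ the expectation when $Z_0=z$, and \[ v^*_\theta(z)=\sup_{\tau}\ \mathbb E^\theta_z\Big\{\sum_{t=0}^{\tau-1}\beta^t c_\theta(Z_t)+\beta^\tau r_\theta(Z_\tau)\Big\},\qquad \psi^*_\theta(y)=c_\theta(y)+\beta\int v^*_\theta(x',y')\,d\mathbb F^\theta_y(x',y'), \] the supremum being over almost surely finite stopping times $\tau$ of the filtration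 generated by $(Z_t)$. \textbf{Assumptions.} (1) (Drift.) For every $\theta$ there are a measurable $g_\theta:\mathsf Z\to[0,\infty)$, an integer $n_\theta\ge 0$ and reals $m_\theta,d_\theta\ge 0$ with $\beta m_\theta<1$ such that, for all $z\in\mathsf Z$, \[ \max\big\{\mathbb E^\theta_z|r_\theta(Z_{n_\theta})|,\ \mathbb E^\theta_z|c_\theta(Z_{n_\theta})|\big\}\le g_\theta(z) \quad\text{and}\quad \int g_\theta(z')P_\theta(z,dz')\le m_\theta g_\theta(z)+d_\theta . \] Moreover $n:=\sup_\theta n_\theta$, $m:=\sup_\theta m_\theta$ and $d:=\sup_\theta d_\theta$ are finite and $\beta m<1$. Fix $m',d'>0$ with $m+2m'>1$, $\beta(m+2m')<1$ and $d'\ge d/(m+2m'-1)$, and put \[ \ell(z,\theta):=m'\Big(\sum_{t=1}^{n-1}\mathbb E^\theta_z|r_\theta(Z_t)|+\sum_{t=0}^{n-1}\mathbb E^\theta_z|c_\theta(Z_t)|\Big)+g_\theta(z)+d'. \] (2) (Feller.) For every bounded continuous $h:\mathsf Z\to\mathbb R$ the map $(z,\theta)\mapsto\int h(z')P_\theta(z,dz')$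 is continuous. (3) (Continuity.) The maps $(z,\theta)\mapsto c_\theta(z)$, $r_\theta(z)$, $\ell(z,\theta)$, $\int|r_\theta(z')|P_\theta(z,dz')$ and $\int\ell(z',\theta)P_\theta(z,dz')$ are finite and continuous on $\mathsf Z\times\Theta$. (4) (Reservation threshold.) For every $\theta$, $r_\theta$ is strictly monotone in $x$ (either strictly increasing in $x$ for all $y$, or strictly decreasing in $x$ for all $y$), and for every $y\in\mathsf Y$ there is $x\in\mathsf X$ with $r_\theta(x,y)=\psi^*_\theta(y)$. \textbf{Conclusion.} For every $\theta$ there is a unique decision threshold $\bar x_\theta:\mathsf Y\to\mathsf X$, i.e. a function with $r_\theta(\bar x_\theta(y),y)=\psi^*_\theta(y)$ for all $y\in\mathsf Y$, and the map $(y,\theta)\mapsto\bar x_\theta(y)$ is continuous on $\mathsf Y\times\Theta$. -/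

import Mathlib

open MeasureTheory ProbabilityTheory
open scoped ENNReal NNReal BoundedContinuousFunction

noncomputable section

/-! ### Optimal stopping problems -/

/-- The primitives of an optimal timing problem on a measurable state space `Z`: a stochastic
kernel `P`, a measurable exit payoff `r` and a measurable flow continuation payoff `c`. -/
structure StoppingProblem (Z : Type*) [MeasurableSpace Z] where
  P : Kernel Z Z
  markov : IsMarkovKernel P
  r : Z → ℝ
  c : Z → ℝ
  measurable_r : Measurable r
  measurable_c : Measurable c

namespace StoppingProblem

variable {Z : Type*} [MeasurableSpace Z]

instance instMarkov (D : StoppingProblem Z) : IsMarkovKernel D.P := D.markov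

/-- The conditional law of `Z_{t+1}` given the history `(Z_0, …, Z_t)`; it depends on `Z_t` only. -/
def historyKernel (D : StoppingProblem Z) (t : ℕ) :
    Kernel ((i : Finset.Iic t) → (fun _ : ℕ => Z) i) Z :=
  D.P.comap (fun h => h ⟨t, Finset.mem_Iic.2 le_rfl⟩) (measurable_pi_apply _)

instance instMarkovHistory (D : StoppingProblem Z) (t : ℕ) :
    IsMarkovKernel (D.historyKernel t) := by
  unfold historyKernel; infer_instance

/-- `ℙ_z`: the law, on the canonical sequence space `ℕ → Z`, of the time-homogeneous Markov process
with stochastic kernel `P` started at `z`. The process itself is `Z_t(ω) = ω t`. -/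
def pathLaw (D : StoppingProblem Z) (z : Z) : Measure (ℕ → Z) :=
  Kernel.trajMeasure (X := fun _ : ℕ => Z) (Measure.dirac z) D.historyKernel

/-- The set of (almost surely finite) stopping times for the filtration generated by the
canonical process. -/
def stoppingTimes (D : StoppingProblem Z) : Set ((ℕ → Z) → WithTop ℕ) :=
  {τ | IsStoppingTime (Filtration.piLE (X := fun _ : ℕ => Z)) τ ∧
    ∀ z, ∀ᵐ ω ∂(D.pathLaw z), τ ω ≠ ⊤}

/-- The discounted payoff of stopping at time `k`:
`∑_{t < k} β ^ t c(Z_t) + β ^ k r(Z_k)`. -/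
def payoff (D : StoppingProblem Z) (β : ℝ) (ω : ℕ → Z) (k : ℕ) : ℝ :=
  (∑ t ∈ Finset.range k, β ^ t * D.c (ω t)) + β ^ k * D.r (ω k)

/-- The value function `v*`. (The default `0` in `untopD` is used on a null set only.) -/
def value (D : StoppingProblem Z) (β : ℝ) (z : Z) : ℝ :=
  sSup ((fun τ : (ℕ → Z) → WithTop ℕ => ∫ ω, D.payoff β ω ((τ ω).untopD 0) ∂(D.pathLaw z)) ''
    D.stoppingTimes)

/-- The continuation value function `ψ*(z) = c(z) + β ∫ v*(z') P(z, dz')`. -/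
def contValue (D : StoppingProblem Z) (β : ℝ) (z : Z) : ℝ :=
  D.c z + β * ∫ z', D.value β z' ∂(D.P z)

/-- `𝔼_z |h(Z_t)| = ∫ |h(z')| P^t(z, dz')`, a number in `[0, ∞]`. -/
def absMoment (D : StoppingProblem Z) (h : Z → ℝ) (t : ℕ) (z : Z) : ℝ≥0∞ :=
  ∫⁻ z', ENNReal.ofReal |h z'| ∂((D.P ^ t) z)

/-- The drift assumption, with function `g` and constants `n`, `m`, `d`. -/
structure Drift (D : StoppingProblem Z) (β : ℝ) (g : Z → ℝ≥0) (n : ℕ) (m d : ℝ≥0) : Prop where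
  measurable_g : Measurable g
  discount : β * m < 1
  exit_le : ∀ z, D.absMoment D.r n z ≤ g z
  flow_le : ∀ z, D.absMoment D.c n z ≤ g z
  drift : ∀ z, ∫⁻ z', (g z' : ℝ≥0∞) ∂(D.P z) ≤ (m : ℝ≥0∞) * g z + d

/-- The weight function
`ℓ(z) = m' (∑_{t=1}^{n-1} 𝔼_z |r(Z_t)| + ∑_{t=0}^{n-1} 𝔼_z |c(Z_t)|) + g(z) + d'`,
a number in `[0, ∞]`. -/
def weight (D : StoppingProblem Z) (g : Z → ℝ≥0) (n : ℕ) (m' d' : ℝ≥0) (z : Z) : ℝ≥0∞ :=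
  (m' : ℝ≥0∞) * ((∑ t ∈ Finset.Ico 1 n, D.absMoment D.r t z) +
    ∑ t ∈ Finset.range n, D.absMoment D.c t z) + g z + d'

end StoppingProblem

/-! ### Parametric families -/

/-- A `[0, ∞]`-valued function is everywhere finite, and continuous as a real function. -/
def FiniteContinuous {A : Type*} [TopologicalSpace A] (f : A → ℝ≥0∞) : Prop :=
  (∀ a, f a ≠ ∞) ∧ Continuous fun a => (f a).toReal

section Parametric

variable {Z Θ : Type*} [MeasurableSpace Z]

/-- The drift assumption holds at every parameter, and with `n = sup n_θ`, `m = sup m_θ`,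
`d = sup d_θ` one has `β m < 1` and `n, d < ∞`. -/
structure ParamDrift (D : Θ → StoppingProblem Z) (β : ℝ) (g : Θ → Z → ℝ≥0) (n : Θ → ℕ)
    (m d : Θ → ℝ≥0) : Prop where
  drift : ∀ θ, (D θ).Drift β (g θ) (n θ) (m θ) (d θ)
  bdd_n : BddAbove (Set.range n)
  bdd_m : BddAbove (Set.range m)
  bdd_d : BddAbove (Set.range d)
  discount : β * ((⨆ θ, m θ : ℝ≥0) : ℝ) < 1

/-- The admissible constants `m'` and `d'` in the definition of the weight function. -/
structure WeightConstants (β : ℝ) (m d m' d' : ℝ≥0) : Prop where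
  pos_m' : 0 < m'
  pos_d' : 0 < d'
  one_lt : 1 < (m : ℝ) + 2 * m'
  discount : β * ((m : ℝ) + 2 * m') < 1
  le_d' : (d : ℝ) / ((m : ℝ) + 2 * m' - 1) ≤ d'

/-- The parametric weight `ℓ(z, θ)`, built with `n = sup n_θ`. -/
def paramWeight (D : Θ → StoppingProblem Z) (g : Θ → Z → ℝ≥0) (n : Θ → ℕ) (m' d' : ℝ≥0)
    (z : Z) (θ : Θ) : ℝ≥0∞ :=
  (D θ).weight (g θ) (⨆ θ', n θ') m' d' z

variable [TopologicalSpace Z] [TopologicalSpace Θ]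

/-- The parametric Feller property. -/
def ParamFeller (D : Θ → StoppingProblem Z) : Prop :=
  ∀ h : Z →ᵇ ℝ, Continuous fun p : Z × Θ => ∫ z', h z' ∂((D p.2).P p.1)

/-- The parametric continuity assumption. -/
structure ParamCont (D : Θ → StoppingProblem Z) (g : Θ → Z → ℝ≥0) (n : Θ → ℕ)
    (m' d' : ℝ≥0) : Prop where
  cont_c : Continuous fun p : Z × Θ => (D p.2).c p.1
  cont_r : Continuous fun p : Z × Θ => (D p.2).r p.1
  cont_weight : FiniteContinuous fun p : Z × Θ => paramWeight D g n m' d' p.1 p.2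
  cont_int_r : FiniteContinuous fun p : Z × Θ =>
    ∫⁻ z', ENNReal.ofReal |(D p.2).r z'| ∂((D p.2).P p.1)
  cont_int_weight : FiniteContinuous fun p : Z × Θ =>
    ∫⁻ z', paramWeight D g n m' d' z' p.2 ∂((D p.2).P p.1)

end Parametric

/-! ### Threshold state problems -/

/-- A stopping problem on `X × Y` with conditionally independent transitions: the law `F y` of the
next state `(x', y')` depends on the current environment `y` only, and so does the flow
continuation payoff. -/
structure ThresholdProblem (X Y : Type*) [MeasurableSpace X] [MeasurableSpace Y] where
  F : Kernel Y (X × Y)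
  markov : IsMarkovKernel F
  r : X × Y → ℝ
  c : Y → ℝ
  measurable_r : Measurable r
  measurable_c : Measurable c

namespace ThresholdProblem

variable {X Y : Type*} [MeasurableSpace X] [MeasurableSpace Y]

/-- The underlying stopping problem, with `P((x, y), ·) = F_y`. -/
def toStopping (T : ThresholdProblem X Y) : StoppingProblem (X × Y) where
  P := T.F.comap Prod.snd measurable_snd
  markov := by
    have := T.markov
    infer_instance
  r := T.r
  c := fun z => T.c z.2
  measurable_r := T.measurable_r
  measurable_c := T.measurable_c.comp measurable_snd

/-- The continuation value as a function of the environment,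
`ψ*(y) = c(y) + β ∫ v*(x', y') dF_y(x', y')`. -/
def contValue (T : ThresholdProblem X Y) (β : ℝ) (y : Y) : ℝ :=
  T.c y + β * ∫ z', T.toStopping.value β z' ∂(T.F y)

theorem contValue_toStopping (T : ThresholdProblem X Y) (β : ℝ) (x : X) (y : Y) :
    T.toStopping.contValue β (x, y) = T.contValue β y := rfl

/-- The exit payoff is strictly monotone in the threshold state, and for every environment there
is a threshold state at which stopping and continuing are equally good. -/
structure HasReservation [Preorder X] (T : ThresholdProblem X Y) (β : ℝ) : Prop where
  strict : (∀ y, StrictMono fun x => T.r (x, y)) ∨ (∀ y, StrictAnti fun x => T.r (x, y))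
  exists_indifferent : ∀ y, ∃ x, T.r (x, y) = T.contValue β y

/-- `xbar : Y → X` is a decision threshold: `r(xbar(y), y) = ψ*(y)` for every `y`. -/
def IsDecisionThreshold (T : ThresholdProblem X Y) (β : ℝ) (xbar : Y → X) : Prop :=
  ∀ y, T.r (xbar y, y) = T.contValue β y

end ThresholdProblem

end

noncomputable section

open Filter Topology

/-! For fixed `(y, θ)` the threshold is the unique root in `x` of `r_θ(x, y) = ψ*_θ(y)`, by strict
monotonicity. It is continuous as soon as `r` and `ψ*` are: if `a` is not the root at `p`, the
strict comparisons of `r(a, ·)` with `ψ*` and with `r` at the old root persist near `p` and keep the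
root on the same side of `a`. The substance is therefore the joint continuity of `ψ*`,
`continuous_contValue`.

No fixed point argument is used; `ψ*` is a locally uniform limit of finite horizon continuation
values. Backward induction solves the horizon `N` problem (`integral_payoff_stopIndex_le`,
`integral_payoff_greedyTime`), and forcing exit at `N` costs at most `3 ∑_{t ≥ N} β^t (𝔼|r(Z_t)| +
𝔼|c(Z_t)|)` (`integral_payoff_le`). The drift condition bounds the moments at times `t ≥ 1` by `K_t
ℓ(z, θ)`, where `K_t` grows like `t M^t` at most, with `M = max(sup m_θ, 1)` and `β M < 1`. The
error is thus `a_N ℓ` with `a_N → 0` independent of `(z, θ)`, and `ℓ` is locally bounded.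

Each finite horizon value is continuous by induction on `N`: it is dominated by `|r| + C ℓ`, whose
integral is continuous, so the Feller property and a dominated convergence theorem for weakly
converging laws apply (`continuous_integral_of_abs_le`). -/

theorem map_eval_zero_trajMeasure {X : ℕ → Type*} [∀ n, MeasurableSpace (X n)]
    (μ : Measure (X 0)) [IsProbabilityMeasure μ]
    (κ : (n : ℕ) → Kernel ((i : Finset.Iic n) → X i) (X (n + 1))) [∀ n, IsMarkovKernel (κ n)] :
    (Kernel.trajMeasure μ κ).map (fun ω => ω 0) = μ := by
  -- Of the identification of `X 0` with histories of length one, only measurability and the zeroth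
  -- coordinate matter.
  have key : ∀ e : X 0 → (i : Finset.Iic 0) → X i, Measurable e →
      (∀ x, e x ⟨0, Finset.mem_Iic.2 le_rfl⟩ = x) →
      ((Kernel.traj κ 0) ∘ₘ (μ.map e)).map (fun ω => ω 0) = μ := by
    intro e he hx
    have h : (fun ω : (n : ℕ) → X n => ω 0) =
        (fun h : (i : Finset.Iic 0) → X i => h ⟨0, Finset.mem_Iic.2 le_rfl⟩) ∘
          Preorder.frestrictLe 0 := rfl
    have hm : Measurable ((fun h : (i : Finset.Iic 0) → X i => h ⟨0, Finset.mem_Iic.2 le_rfl⟩) ∘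
        Preorder.frestrictLe₂ (π := X) (le_refl 0)) :=
      (measurable_pi_apply _).comp (Preorder.measurable_frestrictLe₂ _)
    rw [h, ← Measure.map_map (measurable_pi_apply _) (by fun_prop),
      Measure.map_comp _ _ (by fun_prop), Kernel.traj_map_frestrictLe_of_le le_rfl,
      Measure.deterministic_comp_eq_map,
      Measure.map_map (measurable_pi_apply _) (Preorder.measurable_frestrictLe₂ _),
      Measure.map_map hm he]
    convert Measure.map_id
    ext x
    exact hx x
  exact key _ (MeasurableEquiv.measurable _) fun _ => rfl

namespace StoppingProblem

section SingleProblem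

variable {Z : Type*} [MeasurableSpace Z] (D : StoppingProblem Z)

/-! ### The Markov property of the canonical process -/

instance isProbabilityMeasure_pathLaw (z : Z) : IsProbabilityMeasure (D.pathLaw z) := by
  unfold pathLaw; infer_instance

theorem map_eval_zero_pathLaw (z : Z) :
    (D.pathLaw z).map (fun ω => ω 0) = Measure.dirac z :=
  map_eval_zero_trajMeasure _ _

theorem map_history_pathLaw (z : Z) (t : ℕ) :
    (D.pathLaw z).map (fun ω => (Preorder.frestrictLe t ω, ω (t + 1))) =
      (D.pathLaw z).map (Preorder.frestrictLe t) ⊗ₘ D.historyKernel t :=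
  Kernel.map_frestrictLe_trajMeasure_compProd_eq_map_trajMeasure.symm

theorem exists_preimage_of_measurableSet_piLE {t : ℕ} {A : Set (ℕ → Z)}
    (hA : MeasurableSet[Filtration.piLE (X := fun _ : ℕ => Z) t] A) :
    ∃ B : Set ((i : Finset.Iic t) → (fun _ : ℕ => Z) i), MeasurableSet B ∧
      Preorder.frestrictLe t ⁻¹' B = A := by
  rw [Filtration.piLE_eq_comap_frestrictLe] at hA
  exact hA

theorem lintegral_eval_succ (z : Z) (t : ℕ) {h : Z → ℝ≥0∞} (hh : Measurable h) :
    ∫⁻ ω, h (ω (t + 1)) ∂(D.pathLaw z) = ∫⁻ ω, ∫⁻ z', h z' ∂(D.P (ω t)) ∂(D.pathLaw z) := by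
  have h1 : ∫⁻ ω, h (ω (t + 1)) ∂(D.pathLaw z) = ∫⁻ p, h p.2
      ∂((D.pathLaw z).map (fun ω => ((Preorder.frestrictLe t ω :
        (i : Finset.Iic t) → (fun _ : ℕ => Z) i), ω (t + 1)))) := by
    rw [lintegral_map (by fun_prop) (by fun_prop)]
  rw [h1, map_history_pathLaw, Measure.lintegral_compProd (by fun_prop),
    lintegral_map (Measurable.lintegral_kernel (κ := D.historyKernel t) hh) (by fun_prop)]
  rfl

/-- The Markov property in conditional expectation form: an event known at time `t` is a cylinder
over the history, and the law of history and next state is a composition product. -/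
theorem setIntegral_eval_succ (z : Z) (t : ℕ) {h : Z → ℝ} (hh : Measurable h)
    (hi : Integrable (fun ω : ℕ → Z => h (ω (t + 1))) (D.pathLaw z)) {A : Set (ℕ → Z)}
    (hA : MeasurableSet[Filtration.piLE (X := fun _ : ℕ => Z) t] A) :
    ∫ ω in A, h (ω (t + 1)) ∂(D.pathLaw z) =
      ∫ ω in A, ∫ z', h z' ∂(D.P (ω t)) ∂(D.pathLaw z) := by
  obtain ⟨B, hB, rfl⟩ := exists_preimage_of_measurableSet_piLE hA
  have hm : Measurable fun ω : ℕ → Z => ((Preorder.frestrictLe t ω :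
        (i : Finset.Iic t) → (fun _ : ℕ => Z) i), ω (t + 1)) := by fun_prop
  have hs : Measurable fun p : ((i : Finset.Iic t) → (fun _ : ℕ => Z) i) × Z => h p.2 :=
    hh.comp measurable_snd
  have hi' : Integrable (fun p => h p.2) ((D.pathLaw z).map (fun ω => ((Preorder.frestrictLe t ω :
        (i : Finset.Iic t) → (fun _ : ℕ => Z) i), ω (t + 1)))) := by
    rw [integrable_map_measure hs.aestronglyMeasurable hm.aemeasurable]
    exact hi
  have h1 : ∫ ω in Preorder.frestrictLe t ⁻¹' B, h (ω (t + 1)) ∂(D.pathLaw z) =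
      ∫ p in B ×ˢ Set.univ, h p.2
      ∂((D.pathLaw z).map (fun ω => ((Preorder.frestrictLe t ω :
        (i : Finset.Iic t) → (fun _ : ℕ => Z) i), ω (t + 1)))) := by
    rw [setIntegral_map (hB.prod .univ) hs.aestronglyMeasurable
      hm.aemeasurable]
    congr 2
    ext ω
    simp
  rw [map_history_pathLaw] at hi'
  rw [h1, map_history_pathLaw, Measure.setIntegral_compProd hB .univ hi'.integrableOn,
    setIntegral_map hB _ (by fun_prop)]
  · simp [historyKernel]
  · simp only [Measure.restrict_univ]
    exact (StronglyMeasurable.integral_kernel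
      (κ := D.historyKernel t) hh.stronglyMeasurable).aestronglyMeasurable

theorem lintegral_pow_succ (t : ℕ) (z : Z) {h : Z → ℝ≥0∞} (hh : Measurable h) :
    ∫⁻ z', h z' ∂((D.P ^ (t + 1)) z) = ∫⁻ z', ∫⁻ z'', h z'' ∂(D.P z') ∂((D.P ^ t) z) := by
  rw [pow_succ']
  exact Kernel.lintegral_comp _ _ _ hh

theorem lintegral_pow_succ' (t : ℕ) (z : Z) {h : Z → ℝ≥0∞} (hh : Measurable h) :
    ∫⁻ z', h z' ∂((D.P ^ (t + 1)) z) = ∫⁻ z', ∫⁻ z'', h z'' ∂((D.P ^ t) z') ∂(D.P z) := by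
  rw [pow_succ]
  exact Kernel.lintegral_comp _ _ _ hh

theorem lintegral_pow_add (s t : ℕ) (z : Z) {h : Z → ℝ≥0∞} (hh : Measurable h) :
    ∫⁻ z', h z' ∂((D.P ^ (s + t)) z) = ∫⁻ z', ∫⁻ z'', h z'' ∂((D.P ^ t) z') ∂((D.P ^ s) z) := by
  rw [add_comm, pow_add]
  exact Kernel.lintegral_comp _ _ _ hh

theorem lintegral_pow_zero (z : Z) {h : Z → ℝ≥0∞} (hh : Measurable h) :
    ∫⁻ z', h z' ∂((D.P ^ 0) z) = h z := by
  rw [pow_zero]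
  exact lintegral_dirac' z hh

theorem lintegral_eval (z : Z) (t : ℕ) {h : Z → ℝ≥0∞} (hh : Measurable h) :
    ∫⁻ ω, h (ω t) ∂(D.pathLaw z) = ∫⁻ z', h z' ∂((D.P ^ t) z) := by
  induction t generalizing h with
  | zero =>
    rw [lintegral_pow_zero D z hh,
      ← lintegral_map (f := h) (g := fun ω : ℕ → Z => ω 0) hh (measurable_pi_apply 0),
      map_eval_zero_pathLaw, lintegral_dirac' z hh]
  | succ t ih =>
    rw [lintegral_eval_succ D z t hh, lintegral_pow_succ D t z hh]
    exact ih (Measurable.lintegral_kernel hh)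

theorem integral_eval_zero (z : Z) {h : Z → ℝ} (hh : Measurable h) :
    ∫ ω, h (ω 0) ∂(D.pathLaw z) = h z := by
  rw [← integral_map (φ := fun ω : ℕ → Z => ω 0) (measurable_pi_apply 0).aemeasurable
      hh.aestronglyMeasurable, map_eval_zero_pathLaw, integral_dirac' _ z hh.stronglyMeasurable]

/-! ### Moments -/

/-- The sum `𝔼_z |r(Z_t)| + 𝔼_z |c(Z_t)|`. -/
def totalMoment (t : ℕ) (z : Z) : ℝ≥0∞ := D.absMoment D.r t z + D.absMoment D.c t z

theorem measurable_absMoment {h : Z → ℝ} (hh : Measurable h) (t : ℕ) :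
    Measurable (D.absMoment h t) :=
  Measurable.lintegral_kernel (κ := D.P ^ t) (by fun_prop)

theorem measurable_totalMoment (t : ℕ) : Measurable (D.totalMoment t) :=
  (D.measurable_absMoment D.measurable_r t).add (D.measurable_absMoment D.measurable_c t)

theorem absMoment_zero {h : Z → ℝ} (hh : Measurable h) (z : Z) :
    D.absMoment h 0 z = ENNReal.ofReal |h z| :=
  D.lintegral_pow_zero z (h := fun z => ENNReal.ofReal |h z|) (by fun_prop)

theorem lintegral_absMoment {h : Z → ℝ} (hh : Measurable h) (s t : ℕ) (z : Z) :
    ∫⁻ z', D.absMoment h t z' ∂((D.P ^ s) z) = D.absMoment h (s + t) z :=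
  (D.lintegral_pow_add s t z (h := fun z => ENNReal.ofReal |h z|) (by fun_prop)).symm

theorem lintegral_totalMoment (s t : ℕ) (z : Z) :
    ∫⁻ z', D.totalMoment t z' ∂((D.P ^ s) z) = D.totalMoment (s + t) z := by
  unfold totalMoment
  rw [lintegral_add_left (D.measurable_absMoment D.measurable_r t),
    lintegral_absMoment D D.measurable_r, lintegral_absMoment D D.measurable_c]

theorem lintegral_totalMoment_one (t : ℕ) (z : Z) :
    ∫⁻ z', D.totalMoment t z' ∂(D.P z) = D.totalMoment (t + 1) z := by
  rw [add_comm, ← lintegral_totalMoment, pow_one]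

end SingleProblem

section StopIndex

variable {Z : Type*}

/-! ### Processes stopped at a bounded time -/

/-- The index `τ ∧ t`, as a natural number. -/
def stopIndex (τ : (ℕ → Z) → WithTop ℕ) (t : ℕ) (ω : ℕ → Z) : ℕ :=
  (min (τ ω) (t : WithTop ℕ)).untopD 0

theorem stopIndex_zero (τ : (ℕ → Z) → WithTop ℕ) (ω : ℕ → Z) : stopIndex τ 0 ω = 0 := by
  simp [stopIndex]

theorem stopIndex_of_lt {τ : (ℕ → Z) → WithTop ℕ} {t : ℕ} {ω : ℕ → Z} (h : (t : WithTop ℕ) < τ ω) :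
    stopIndex τ t ω = t := by
  rw [stopIndex, min_eq_right h.le]
  rfl

theorem stopIndex_of_le {τ : (ℕ → Z) → WithTop ℕ} {t : ℕ} {ω : ℕ → Z} (h : τ ω ≤ t) :
    stopIndex τ t ω = (τ ω).untopD 0 := by
  rw [stopIndex, min_eq_left h]

theorem stopIndex_succ_of_lt {τ : (ℕ → Z) → WithTop ℕ} {t : ℕ} {ω : ℕ → Z}
    (h : (t : WithTop ℕ) < τ ω) : stopIndex τ (t + 1) ω = t + 1 := by
  rw [stopIndex, min_eq_right]
  · rfl
  · cases hτ : τ ω with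
    | top => exact le_top
    | coe k =>
      rw [hτ] at h
      exact WithTop.coe_le_coe.2 (Nat.succ_le_of_lt (WithTop.coe_lt_coe.1 h))

/-- Telescoping. The increment from `s` to `s + 1` survives on `{s < τ}`, an event known at time
`s`, so the Markov property can be applied to each term. -/
theorem stopped_eq_sum (F : ℕ → (ℕ → Z) → ℝ) (τ : (ℕ → Z) → WithTop ℕ) (t : ℕ) (ω : ℕ → Z) :
    F (stopIndex τ t ω) ω = F 0 ω + ∑ s ∈ Finset.range t,
      {ω | (s : WithTop ℕ) < τ ω}.indicator (fun ω => F (s + 1) ω - F s ω) ω := by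
  induction t with
  | zero => simp [stopIndex_zero]
  | succ t ih =>
    rw [Finset.sum_range_succ, ← add_assoc, ← ih]
    rcases lt_or_ge (t : WithTop ℕ) (τ ω) with h | h
    · rw [Set.indicator_of_mem (by exact h), stopIndex_of_lt h, stopIndex_succ_of_lt h]
      ring
    · rw [Set.indicator_of_notMem (by exact not_lt.2 h), stopIndex_of_le h, add_zero,
        stopIndex_of_le]
      exact h.trans (WithTop.coe_le_coe.2 t.le_succ)

end StopIndex

section SingleProblem

variable {Z : Type*} [MeasurableSpace Z] (D : StoppingProblem Z)

/-! ### Finite horizon value functions -/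

/-- The value of the problem in which the agent has to exit at time `N` at the latest. -/
def finiteHorizonValue (β : ℝ) : ℕ → Z → ℝ
  | 0 => D.r
  | N + 1 => fun z => max (D.r z) (D.c z + β * ∫ z', finiteHorizonValue β N z' ∂(D.P z))

theorem finiteHorizonValue_succ (β : ℝ) (N : ℕ) (z : Z) :
    D.finiteHorizonValue β (N + 1) z =
      max (D.r z) (D.c z + β * ∫ z', D.finiteHorizonValue β N z' ∂(D.P z)) := rfl

theorem measurable_finiteHorizonValue (β : ℝ) (N : ℕ) :
    Measurable (D.finiteHorizonValue β N) := by
  induction N with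
  | zero => exact D.measurable_r
  | succ N ih =>
    exact D.measurable_r.max (D.measurable_c.add
      (((StronglyMeasurable.integral_kernel (κ := D.P) ih.stronglyMeasurable).measurable).const_mul
        β))

theorem r_le_finiteHorizonValue (β : ℝ) (N : ℕ) (z : Z) : D.r z ≤ D.finiteHorizonValue β N z := by
  cases N with
  | zero => exact le_rfl
  | succ N => exact le_max_left _ _

/-- One kernel step shifts every moment by one, and discounting is dropped. The term `|r z|` stays
separate because the weight contains no time-zero moment of `r`. -/
theorem ofReal_abs_finiteHorizonValue_le {β : ℝ} (hβ : β ∈ Set.Ioo (0 : ℝ) 1) (N : ℕ) (z : Z) :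
    ENNReal.ofReal |D.finiteHorizonValue β N z| ≤
      ENNReal.ofReal |D.r z| + D.absMoment D.c 0 z +
        ∑ t ∈ Finset.range N, D.totalMoment (t + 1) z := by
  induction N generalizing z with
  | zero => exact le_add_right (le_add_right le_rfl)
  | succ N ih =>
    have h1 : ENNReal.ofReal |∫ z', D.finiteHorizonValue β N z' ∂(D.P z)| ≤
        ∑ t ∈ Finset.range (N + 1), D.totalMoment (t + 1) z := by
      have h2 : ∀ z', ENNReal.ofReal |D.finiteHorizonValue β N z'| ≤
          ∑ t ∈ Finset.range (N + 1), D.totalMoment t z' := by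
        intro z'
        rw [Finset.sum_range_succ', add_comm, totalMoment, absMoment_zero D D.measurable_r]
        exact ih z'
      calc ENNReal.ofReal |∫ z', D.finiteHorizonValue β N z' ∂(D.P z)|
          ≤ ∫⁻ z', ENNReal.ofReal |D.finiteHorizonValue β N z'| ∂(D.P z) := by
            have := enorm_integral_le_lintegral_enorm (μ := D.P z) (D.finiteHorizonValue β N)
            simpa only [Real.enorm_eq_ofReal_abs] using this
        _ ≤ ∫⁻ z', ∑ t ∈ Finset.range (N + 1), D.totalMoment t z' ∂(D.P z) := lintegral_mono h2
        _ = _ := by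
            rw [lintegral_finsetSum _ fun t _ => D.measurable_totalMoment t]
            exact Finset.sum_congr rfl fun t _ => D.lintegral_totalMoment_one t z
    have h3 : |D.finiteHorizonValue β (N + 1) z| ≤
        |D.r z| + |D.c z| + |∫ z', D.finiteHorizonValue β N z' ∂(D.P z)| := by
      set I := ∫ z', D.finiteHorizonValue β N z' ∂(D.P z) with hI
      have h4 : |β * I| ≤ |I| := by
        rw [abs_mul, abs_of_pos hβ.1]
        exact mul_le_of_le_one_left (abs_nonneg _) hβ.2.le
      rw [finiteHorizonValue_succ, ← hI]
      refine abs_max_le_max_abs_abs.trans (max_le ?_ ?_)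
      · linarith [abs_nonneg (D.c z), abs_nonneg I]
      · linarith [abs_add_le (D.c z) (β * I), abs_nonneg (D.r z)]
    calc ENNReal.ofReal |D.finiteHorizonValue β (N + 1) z|
        ≤ ENNReal.ofReal (|D.r z| + |D.c z| + |∫ z', D.finiteHorizonValue β N z' ∂(D.P z)|) :=
          ENNReal.ofReal_le_ofReal h3
      _ = ENNReal.ofReal |D.r z| + D.absMoment D.c 0 z +
          ENNReal.ofReal |∫ z', D.finiteHorizonValue β N z' ∂(D.P z)| := by
          rw [ENNReal.ofReal_add (by positivity) (abs_nonneg _),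
            ENNReal.ofReal_add (abs_nonneg _) (abs_nonneg _), absMoment_zero D D.measurable_c]
      _ ≤ _ := by gcongr

/-! ### Integrability along the canonical process -/

theorem integrable_eval_of_absMoment {h : Z → ℝ} (hh : Measurable h) {t : ℕ} {z : Z}
    (hf : D.absMoment h t z ≠ ∞) : Integrable (fun ω : ℕ → Z => h (ω t)) (D.pathLaw z) := by
  refine ⟨(hh.comp (measurable_pi_apply t)).aestronglyMeasurable, ?_⟩
  rw [HasFiniteIntegral]
  simp only [Real.enorm_eq_ofReal_abs]
  rw [D.lintegral_eval z t (h := fun z => ENNReal.ofReal |h z|) (by fun_prop)]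
  exact hf.lt_top

theorem integrable_kernel_of_absMoment {h : Z → ℝ} (hh : Measurable h) {z : Z}
    (hf : D.absMoment h 1 z ≠ ∞) : Integrable h (D.P z) := by
  refine ⟨hh.aestronglyMeasurable, ?_⟩
  rw [HasFiniteIntegral]
  simp only [Real.enorm_eq_ofReal_abs]
  rw [absMoment, pow_one] at hf
  exact hf.lt_top

theorem absMoment_finiteHorizonValue_ne_top (hfin : ∀ t z, D.totalMoment t z ≠ ∞) {β : ℝ}
    (hβ : β ∈ Set.Ioo (0 : ℝ) 1) (N t : ℕ) (z : Z) :
    D.absMoment (D.finiteHorizonValue β N) t z ≠ ∞ := by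
  have h2 : ∀ z', ENNReal.ofReal |D.finiteHorizonValue β N z'| ≤
      ∑ t ∈ Finset.range (N + 1), D.totalMoment t z' := by
    intro z'
    rw [Finset.sum_range_succ', add_comm, totalMoment, absMoment_zero D D.measurable_r]
    exact D.ofReal_abs_finiteHorizonValue_le hβ N z'
  refine ne_top_of_le_ne_top ?_ (lintegral_mono h2)
  rw [lintegral_finsetSum _ fun t _ => D.measurable_totalMoment t]
  simp_rw [lintegral_totalMoment]
  exact ENNReal.sum_ne_top.2 fun s _ => hfin _ _

theorem integrable_finiteHorizonValue_eval (hfin : ∀ t z, D.totalMoment t z ≠ ∞) {β : ℝ}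
    (hβ : β ∈ Set.Ioo (0 : ℝ) 1) (N t : ℕ) (z : Z) :
    Integrable (fun ω : ℕ → Z => D.finiteHorizonValue β N (ω t)) (D.pathLaw z) :=
  D.integrable_eval_of_absMoment (D.measurable_finiteHorizonValue β N)
    (D.absMoment_finiteHorizonValue_ne_top hfin hβ N t z)

theorem integrable_finiteHorizonValue (hfin : ∀ t z, D.totalMoment t z ≠ ∞) {β : ℝ}
    (hβ : β ∈ Set.Ioo (0 : ℝ) 1) (N : ℕ) (z : Z) :
    Integrable (D.finiteHorizonValue β N) (D.P z) :=
  D.integrable_kernel_of_absMoment (D.measurable_finiteHorizonValue β N)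
    (D.absMoment_finiteHorizonValue_ne_top hfin hβ N 1 z)

theorem integrable_r_eval (hfin : ∀ t z, D.totalMoment t z ≠ ∞) (t : ℕ) (z : Z) :
    Integrable (fun ω : ℕ → Z => D.r (ω t)) (D.pathLaw z) :=
  D.integrable_eval_of_absMoment D.measurable_r (ENNReal.add_ne_top.1 (hfin t z)).1

theorem integrable_c_eval (hfin : ∀ t z, D.totalMoment t z ≠ ∞) (t : ℕ) (z : Z) :
    Integrable (fun ω : ℕ → Z => D.c (ω t)) (D.pathLaw z) :=
  D.integrable_eval_of_absMoment D.measurable_c (ENNReal.add_ne_top.1 (hfin t z)).2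

theorem integrable_payoff (hfin : ∀ t z, D.totalMoment t z ≠ ∞) (β : ℝ) (k : ℕ) (z : Z) :
    Integrable (fun ω => D.payoff β ω k) (D.pathLaw z) :=
  (integrable_finsetSum _ fun t _ => (D.integrable_c_eval hfin t z).const_mul _).add
    ((D.integrable_r_eval hfin k z).const_mul _)

/-! ### Optional stopping at a bounded time -/

theorem measurableSet_lt_of_isStoppingTime {τ : (ℕ → Z) → WithTop ℕ}
    (hτ : IsStoppingTime (Filtration.piLE (X := fun _ : ℕ => Z)) τ) (s : ℕ) :
    MeasurableSet[Filtration.piLE (X := fun _ : ℕ => Z) s] {ω | (s : WithTop ℕ) < τ ω} :=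
  hτ.measurableSet_gt s

theorem integrable_stopped {F : ℕ → (ℕ → Z) → ℝ} {μ : Measure (ℕ → Z)}
    {τ : (ℕ → Z) → WithTop ℕ}
    (hτ : IsStoppingTime (Filtration.piLE (X := fun _ : ℕ => Z)) τ) {t : ℕ}
    (hF : ∀ s ≤ t, Integrable (F s) μ) :
    Integrable (fun ω => F (stopIndex τ t ω) ω) μ := by
  simp_rw [stopped_eq_sum F τ t]
  refine (hF 0 t.zero_le).add (integrable_finsetSum _ fun s hs => ?_)
  have hs' := Finset.mem_range.1 hs
  exact ((hF (s + 1) hs').sub (hF s hs'.le)).indicator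
    (Filtration.piLE.le s _ (measurableSet_lt_of_isStoppingTime hτ s))

theorem integral_stopped {F : ℕ → (ℕ → Z) → ℝ} {μ : Measure (ℕ → Z)}
    {τ : (ℕ → Z) → WithTop ℕ}
    (hτ : IsStoppingTime (Filtration.piLE (X := fun _ : ℕ => Z)) τ) {t : ℕ}
    (hF : ∀ s ≤ t, Integrable (F s) μ) :
    ∫ ω, F (stopIndex τ t ω) ω ∂μ = ∫ ω, F 0 ω ∂μ + ∑ s ∈ Finset.range t,
      ∫ ω in {ω | (s : WithTop ℕ) < τ ω}, (F (s + 1) ω - F s ω) ∂μ := by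
  simp_rw [stopped_eq_sum F τ t]
  have hB := fun s => Filtration.piLE.le s _ (measurableSet_lt_of_isStoppingTime hτ s)
  have hi : ∀ s ∈ Finset.range t, Integrable
      ({ω | (s : WithTop ℕ) < τ ω}.indicator (fun ω => F (s + 1) ω - F s ω)) μ := fun s hs =>
    ((hF (s + 1) (Finset.mem_range.1 hs)).sub (hF s (Finset.mem_range.1 hs).le)).indicator (hB s)
  rw [integral_add (hF 0 t.zero_le) (integrable_finsetSum _ hi), integral_finsetSum _ hi]
  congr 1
  exact Finset.sum_congr rfl fun s _ => integral_indicator (hB s)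

/-! ### Dynamic programming over a finite horizon -/

/-- The accumulated flow payoff up to time `t` plus the discounted value of the remaining
problem with horizon `N - t`. -/
def gain (β : ℝ) (N t : ℕ) (ω : ℕ → Z) : ℝ :=
  (∑ s ∈ Finset.range t, β ^ s * D.c (ω s)) + β ^ t * D.finiteHorizonValue β (N - t) (ω t)

theorem integrable_gain (hfin : ∀ t z, D.totalMoment t z ≠ ∞) {β : ℝ}
    (hβ : β ∈ Set.Ioo (0 : ℝ) 1) (N t : ℕ) (z : Z) :
    Integrable (D.gain β N t) (D.pathLaw z) :=
  (integrable_finsetSum _ fun t _ => (D.integrable_c_eval hfin t z).const_mul _).add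
    ((D.integrable_finiteHorizonValue_eval hfin hβ _ t z).const_mul _)

theorem payoff_le_gain {β : ℝ} (hβ : 0 ≤ β) (N k : ℕ) (ω : ℕ → Z) :
    D.payoff β ω k ≤ D.gain β N k ω := by
  unfold payoff gain
  have := D.r_le_finiteHorizonValue β (N - k) (ω k)
  gcongr

/-- The conditional increment of `gain` is the discounted difference between continuing and the
current value: never positive before the horizon, and zero where continuing is optimal. Hence a
supermartingale in general and a martingale up to the greedy time. -/
theorem setIntegral_gain_sub (hfin : ∀ t z, D.totalMoment t z ≠ ∞) {β : ℝ}
    (hβ : β ∈ Set.Ioo (0 : ℝ) 1) (N s : ℕ) (z : Z) {A : Set (ℕ → Z)}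
    (hA : MeasurableSet[Filtration.piLE (X := fun _ : ℕ => Z) s] A) :
    ∫ ω in A, (D.gain β N (s + 1) ω - D.gain β N s ω) ∂(D.pathLaw z) =
      ∫ ω in A, β ^ s * (D.c (ω s) +
        β * ∫ z', D.finiteHorizonValue β (N - s - 1) z' ∂(D.P (ω s)) -
          D.finiteHorizonValue β (N - s) (ω s)) ∂(D.pathLaw z) := by
  have hm := D.measurable_finiteHorizonValue β (N - s - 1)
  have h0 : ∀ ω, D.gain β N (s + 1) ω - D.gain β N s ω =
      β ^ s * (D.c (ω s) - D.finiteHorizonValue β (N - s) (ω s)) +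
        β ^ (s + 1) * D.finiteHorizonValue β (N - s - 1) (ω (s + 1)) := by
    intro ω
    rw [gain, gain, Finset.sum_range_succ, Nat.sub_sub]
    ring
  have h1 : ∀ ω : ℕ → Z, β ^ s * (D.c (ω s) +
        β * ∫ z', D.finiteHorizonValue β (N - s - 1) z' ∂(D.P (ω s)) -
          D.finiteHorizonValue β (N - s) (ω s)) =
      β ^ s * (D.c (ω s) - D.finiteHorizonValue β (N - s) (ω s)) +
        β ^ (s + 1) * ∫ z', D.finiteHorizonValue β (N - s - 1) z' ∂(D.P (ω s)) := by
    intro ω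
    ring
  have hi := D.integrable_finiteHorizonValue_eval hfin hβ (N - s - 1) (s + 1) z
  have hi1 : Integrable (fun ω : ℕ → Z =>
      β ^ s * (D.c (ω s) - D.finiteHorizonValue β (N - s) (ω s))) (D.pathLaw z) :=
    ((D.integrable_c_eval hfin s z).sub
      (D.integrable_finiteHorizonValue_eval hfin hβ (N - s) s z)).const_mul _
  have hi2 : Integrable (fun ω : ℕ → Z =>
      ∫ z', D.finiteHorizonValue β (N - s - 1) z' ∂(D.P (ω s))) (D.pathLaw z) := by
    refine D.integrable_eval_of_absMoment
      (h := fun z => ∫ z', D.finiteHorizonValue β (N - s - 1) z' ∂(D.P z))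
      (StronglyMeasurable.integral_kernel (κ := D.P) hm.stronglyMeasurable).measurable ?_
    refine ne_top_of_le_ne_top
      (D.absMoment_finiteHorizonValue_ne_top hfin hβ (N - s - 1) (s + 1) z) ?_
    rw [absMoment, absMoment, lintegral_pow_succ D s z
      (h := fun z => ENNReal.ofReal |D.finiteHorizonValue β (N - s - 1) z|) (by fun_prop)]
    refine lintegral_mono fun z' => ?_
    simp only [← Real.enorm_eq_ofReal_abs]
    exact enorm_integral_le_lintegral_enorm _
  simp_rw [h0, h1]
  rw [integral_add hi1.integrableOn (hi.const_mul _).integrableOn,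
    integral_add hi1.integrableOn (hi2.const_mul _).integrableOn, integral_const_mul,
    integral_const_mul, integral_const_mul, D.setIntegral_eval_succ z s hm hi hA]

theorem continuation_le_finiteHorizonValue (β : ℝ) {N s : ℕ} (hs : s < N) (z : Z) :
    D.c z + β * ∫ z', D.finiteHorizonValue β (N - s - 1) z' ∂(D.P z) ≤
      D.finiteHorizonValue β (N - s) z := by
  obtain ⟨k, hk⟩ : ∃ k, N - s = k + 1 := ⟨N - s - 1, by omega⟩
  rw [hk, Nat.add_sub_cancel, finiteHorizonValue_succ]
  exact le_max_right _ _

theorem integral_gain_zero (β : ℝ) (N : ℕ) (z : Z) :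
    ∫ ω, D.gain β N 0 ω ∂(D.pathLaw z) = D.finiteHorizonValue β N z := by
  simpa [gain] using D.integral_eval_zero z (D.measurable_finiteHorizonValue β N)

theorem integral_payoff_stopIndex_le (hfin : ∀ t z, D.totalMoment t z ≠ ∞) {β : ℝ}
    (hβ : β ∈ Set.Ioo (0 : ℝ) 1) (N : ℕ) (z : Z) {τ : (ℕ → Z) → WithTop ℕ}
    (hτ : IsStoppingTime (Filtration.piLE (X := fun _ : ℕ => Z)) τ) :
    ∫ ω, D.payoff β ω (stopIndex τ N ω) ∂(D.pathLaw z) ≤ D.finiteHorizonValue β N z := by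
  calc ∫ ω, D.payoff β ω (stopIndex τ N ω) ∂(D.pathLaw z)
      ≤ ∫ ω, D.gain β N (stopIndex τ N ω) ω ∂(D.pathLaw z) :=
        integral_mono
          (integrable_stopped (F := fun k ω => D.payoff β ω k) hτ
            fun s _ => D.integrable_payoff hfin β s z)
          (integrable_stopped hτ fun s _ => D.integrable_gain hfin hβ N s z)
          fun ω => D.payoff_le_gain hβ.1.le N _ ω
    _ ≤ D.finiteHorizonValue β N z := by
        rw [integral_stopped hτ fun s _ => D.integrable_gain hfin hβ N s z,
          integral_gain_zero, add_le_iff_nonpos_right]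
        refine Finset.sum_nonpos fun s hs => ?_
        rw [D.setIntegral_gain_sub hfin hβ N s z
          (measurableSet_lt_of_isStoppingTime hτ s)]
        refine integral_nonpos fun ω => ?_
        have := D.continuation_le_finiteHorizonValue β (Finset.mem_range.1 hs) (ω s)
        exact mul_nonpos_of_nonneg_of_nonpos (pow_nonneg hβ.1.le s) (by linarith)

theorem exists_exit_eq_finiteHorizonValue (β : ℝ) (N : ℕ) (ω : ℕ → Z) :
    ∃ k, D.r (ω k) = D.finiteHorizonValue β (N - k) (ω k) :=
  ⟨N, by rw [Nat.sub_self]; rfl⟩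

open Classical in
/-- The first time at which exiting is optimal when the horizon is `N`. -/
def greedyTime (β : ℝ) (N : ℕ) (ω : ℕ → Z) : ℕ :=
  Nat.find (D.exists_exit_eq_finiteHorizonValue β N ω)

theorem greedyTime_le (β : ℝ) (N : ℕ) (ω : ℕ → Z) : D.greedyTime β N ω ≤ N := by
  classical
  exact Nat.find_min' _ (by rw [Nat.sub_self]; rfl)

theorem measurable_eval_piLE {k i : ℕ} (h : k ≤ i) :
    Measurable[Filtration.piLE (X := fun _ : ℕ => Z) i] fun ω : ℕ → Z => ω k := by
  rw [Filtration.piLE_eq_comap_frestrictLe]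
  exact (measurable_pi_apply (⟨k, Finset.mem_Iic.2 h⟩ : Finset.Iic i)).comp
    (comap_measurable (Preorder.frestrictLe (π := fun _ : ℕ => Z) i))

theorem isStoppingTime_greedyTime (β : ℝ) (N : ℕ) :
    IsStoppingTime (Filtration.piLE (X := fun _ : ℕ => Z))
      fun ω => ((D.greedyTime β N ω : ℕ) : WithTop ℕ) := by
  classical
  intro i
  have : {ω | ((D.greedyTime β N ω : ℕ) : WithTop ℕ) ≤ (i : WithTop ℕ)} =
      ⋃ k ∈ Set.Iic i, (fun ω : ℕ → Z => ω k) ⁻¹'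
        {z | D.r z = D.finiteHorizonValue β (N - k) z} := by
    ext ω
    simp [greedyTime, Nat.find_le_iff]
  change MeasurableSet[Filtration.piLE (X := fun _ : ℕ => Z) i]
    {ω | ((D.greedyTime β N ω : ℕ) : WithTop ℕ) ≤ (i : WithTop ℕ)}
  rw [this]
  refine @MeasurableSet.biUnion _ _ (Filtration.piLE (X := fun _ : ℕ => Z) i) _ _
    (Set.to_countable _) fun k hk => measurable_eval_piLE hk ?_
  exact measurableSet_eq_fun D.measurable_r (D.measurable_finiteHorizonValue β _)

theorem integral_payoff_greedyTime (hfin : ∀ t z, D.totalMoment t z ≠ ∞) {β : ℝ}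
    (hβ : β ∈ Set.Ioo (0 : ℝ) 1) (N : ℕ) (z : Z) :
    ∫ ω, D.payoff β ω (D.greedyTime β N ω) ∂(D.pathLaw z) = D.finiteHorizonValue β N z := by
  classical
  have hτ := D.isStoppingTime_greedyTime β N
  set τ : (ℕ → Z) → WithTop ℕ := fun ω => ((D.greedyTime β N ω : ℕ) : WithTop ℕ) with hτdef
  have hidx : ∀ ω, stopIndex τ N ω = D.greedyTime β N ω := fun ω =>
    stopIndex_of_le (WithTop.coe_le_coe.2 (D.greedyTime_le β N ω))
  have hpay : ∀ ω, D.payoff β ω (D.greedyTime β N ω) =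
      D.gain β N (stopIndex τ N ω) ω := by
    intro ω
    have : D.r (ω (D.greedyTime β N ω)) = _ :=
      Nat.find_spec (D.exists_exit_eq_finiteHorizonValue β N ω)
    rw [hidx, gain, payoff, this]
    rfl
  simp_rw [hpay]
  rw [integral_stopped hτ fun s _ => D.integrable_gain hfin hβ N s z,
    integral_gain_zero, add_eq_left]
  refine Finset.sum_eq_zero fun s hs => ?_
  have hs' := Finset.mem_range.1 hs
  rw [D.setIntegral_gain_sub hfin hβ N s z (measurableSet_lt_of_isStoppingTime hτ s)]
  refine setIntegral_eq_zero_of_forall_eq_zero fun ω hω => ?_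
  have hlt : s < D.greedyTime β N ω := WithTop.coe_lt_coe.1 hω
  have hne := Nat.find_min (D.exists_exit_eq_finiteHorizonValue β N ω) hlt
  obtain ⟨k, hk⟩ : ∃ k, N - s = k + 1 := ⟨N - s - 1, by omega⟩
  rw [hk] at hne ⊢
  rw [Nat.add_sub_cancel, finiteHorizonValue_succ]
  rw [finiteHorizonValue_succ] at hne
  -- Before the greedy time exit does not attain the maximum, so continuing does, and the increment
  -- vanishes.
  rw [max_eq_right, sub_self, mul_zero]
  by_contra hcon
  exact hne (max_eq_left (not_le.1 hcon).le).symm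

theorem greedyTime_mem_stoppingTimes (β : ℝ) (N : ℕ) :
    (fun ω => ((D.greedyTime β N ω : ℕ) : WithTop ℕ)) ∈ D.stoppingTimes :=
  ⟨D.isStoppingTime_greedyTime β N, fun _ => Eventually.of_forall fun _ => WithTop.coe_ne_top⟩

end SingleProblem

section SingleProblem

variable {Z : Type*} [MeasurableSpace Z] (D : StoppingProblem Z)

/-! ### Approximation of the value function by finite horizon values -/

/-- A bound on the loss caused by forcing exit at time `N`. -/
def tailMoment (β : ℝ) (N : ℕ) (z : Z) : ℝ≥0∞ :=
  3 * ∑' t, ENNReal.ofReal β ^ (t + N) * D.totalMoment (t + N) z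

theorem lintegral_tailMoment (β : ℝ) (N : ℕ) (z : Z) :
    ∫⁻ z', D.tailMoment β N z' ∂(D.P z) =
      3 * ∑' t, ENNReal.ofReal β ^ (t + N) * D.totalMoment (t + N + 1) z := by
  unfold tailMoment
  rw [lintegral_const_mul _
      (Measurable.tsum fun t => (D.measurable_totalMoment (t + N)).const_mul _),
    lintegral_tsum fun t => ((D.measurable_totalMoment (t + N)).const_mul _).aemeasurable]
  congr 2
  ext t
  rw [lintegral_const_mul _ (D.measurable_totalMoment (t + N)), lintegral_totalMoment_one]

/-- For `k ≥ N` the difference consists of the flow payoffs on `[N, k)`, the exit payoff at `k` and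
the exit payoff at `N`. Each is at most the same tail series, whence the factor 3. -/
theorem ofReal_abs_payoff_sub_le {β : ℝ} (hβ : 0 ≤ β) (N k : ℕ) (ω : ℕ → Z) :
    ENNReal.ofReal |D.payoff β ω k - D.payoff β ω (min k N)| ≤
      3 * ∑' t, ENNReal.ofReal β ^ (t + N) *
        (ENNReal.ofReal |D.r (ω (t + N))| + ENNReal.ofReal |D.c (ω (t + N))|) := by
  rcases le_total k N with h | h
  · rw [min_eq_left h, sub_self, abs_zero, ENNReal.ofReal_zero]
    exact zero_le
  obtain ⟨j, rfl⟩ := Nat.exists_eq_add_of_le' h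
  rw [min_eq_right h]
  set S := ∑' t, ENNReal.ofReal β ^ (t + N) *
        (ENNReal.ofReal |D.r (ω (t + N))| + ENNReal.ofReal |D.c (ω (t + N))|) with hS
  have habs : ∀ (t : ℕ) (x : ℝ), ENNReal.ofReal |β ^ t * x| =
      ENNReal.ofReal β ^ t * ENNReal.ofReal |x| := by
    intro t x
    rw [abs_mul, abs_of_nonneg (pow_nonneg hβ t), ENNReal.ofReal_mul (pow_nonneg hβ t),
      ENNReal.ofReal_pow hβ]
  have hr : ∀ t, ENNReal.ofReal |β ^ (t + N) * D.r (ω (t + N))| ≤ S := by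
    intro t
    rw [habs]
    refine le_trans ?_ (ENNReal.le_tsum t)
    gcongr
    exact le_self_add
  have hc : ENNReal.ofReal |∑ t ∈ Finset.range j, β ^ (t + N) * D.c (ω (t + N))| ≤ S := by
    refine le_trans ?_ (ENNReal.sum_le_tsum (Finset.range j))
    refine (ENNReal.ofReal_le_ofReal (Finset.abs_sum_le_sum_abs _ _)).trans ?_
    rw [ENNReal.ofReal_sum_of_nonneg fun _ _ => abs_nonneg _]
    refine Finset.sum_le_sum fun t _ => ?_
    rw [habs]
    gcongr
    exact le_add_self
  have hsplit : D.payoff β ω (j + N) - D.payoff β ω N =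
      ∑ t ∈ Finset.range j, β ^ (t + N) * D.c (ω (t + N)) +
        β ^ (j + N) * D.r (ω (j + N)) - β ^ (0 + N) * D.r (ω (0 + N)) := by
    rw [payoff, payoff, add_comm j N, Finset.sum_range_add, zero_add]
    simp_rw [add_comm N]
    ring
  rw [hsplit]
  calc ENNReal.ofReal |∑ t ∈ Finset.range j, β ^ (t + N) * D.c (ω (t + N)) +
        β ^ (j + N) * D.r (ω (j + N)) - β ^ (0 + N) * D.r (ω (0 + N))|
      ≤ ENNReal.ofReal (|∑ t ∈ Finset.range j, β ^ (t + N) * D.c (ω (t + N))| +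
        |β ^ (j + N) * D.r (ω (j + N))| + |β ^ (0 + N) * D.r (ω (0 + N))|) := by
        refine ENNReal.ofReal_le_ofReal ((abs_sub _ _).trans ?_)
        gcongr
        exact abs_add_le _ _
    _ ≤ S + S + S := by
        rw [ENNReal.ofReal_add (by positivity) (abs_nonneg _),
          ENNReal.ofReal_add (abs_nonneg _) (abs_nonneg _)]
        exact add_le_add (add_le_add hc (hr j)) (hr 0)
    _ = 3 * S := by ring

theorem lintegral_tail_pathLaw (β : ℝ) (N : ℕ) (z : Z) :
    ∫⁻ ω, (3 * ∑' t, ENNReal.ofReal β ^ (t + N) *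
        (ENNReal.ofReal |D.r (ω (t + N))| + ENNReal.ofReal |D.c (ω (t + N))|)) ∂(D.pathLaw z) =
      D.tailMoment β N z := by
  have hr := D.measurable_r
  have hc := D.measurable_c
  have hm : ∀ t, Measurable fun ω : ℕ → Z => ENNReal.ofReal β ^ (t + N) *
      (ENNReal.ofReal |D.r (ω (t + N))| + ENNReal.ofReal |D.c (ω (t + N))|) := fun t => by fun_prop
  rw [lintegral_const_mul _ (Measurable.tsum hm), lintegral_tsum fun t => (hm t).aemeasurable,
    tailMoment]
  congr 2
  ext t
  rw [lintegral_const_mul _ (by fun_prop), lintegral_add_left (by fun_prop),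
    D.lintegral_eval z (t + N) (h := fun z => ENNReal.ofReal |D.r z|) (by fun_prop),
    D.lintegral_eval z (t + N) (h := fun z => ENNReal.ofReal |D.c z|) (by fun_prop)]
  rfl

variable {D}

theorem totalMoment_ne_top_of_tsum {β : ℝ} (hβ : 0 < β) {z : Z}
    (hsum : ∑' t, ENNReal.ofReal β ^ t * D.totalMoment t z ≠ ∞) (t : ℕ) :
    D.totalMoment t z ≠ ∞ := by
  have h := ne_top_of_le_ne_top hsum (ENNReal.le_tsum t)
  intro hcon
  rw [hcon, ENNReal.mul_top (pow_ne_zero _ (ENNReal.ofReal_pos.2 hβ).ne')] at h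
  exact h rfl

theorem tendsto_tailMoment {β : ℝ} {z : Z}
    (hsum : ∑' t, ENNReal.ofReal β ^ t * D.totalMoment t z ≠ ∞) :
    Tendsto (fun N => D.tailMoment β N z) atTop (𝓝 0) := by
  have := ENNReal.Tendsto.const_mul (a := 3) (ENNReal.tendsto_sum_nat_add _ hsum)
    (Or.inr (by norm_num))
  rwa [mul_zero] at this

theorem tailMoment_ne_top {β : ℝ} {z : Z}
    (hsum : ∑' t, ENNReal.ofReal β ^ t * D.totalMoment t z ≠ ∞) (N : ℕ) :
    D.tailMoment β N z ≠ ∞ :=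
  ENNReal.mul_ne_top (by norm_num) (ne_top_of_le_ne_top hsum
    (ENNReal.tsum_comp_le_tsum_of_injective (add_left_injective N) _))

/-- Multiplied by `β > 0`, the integral becomes the tail from `N + 1`, which is finite. -/
theorem lintegral_tailMoment_ne_top {β : ℝ} (hβ : 0 < β) {z : Z}
    (hsum : ∑' t, ENNReal.ofReal β ^ t * D.totalMoment t z ≠ ∞) (N : ℕ) :
    ∫⁻ z', D.tailMoment β N z' ∂(D.P z) ≠ ∞ := by
  have h := D.tailMoment_ne_top hsum (N + 1)
  rw [lintegral_tailMoment]
  intro hcon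
  have h2 : ENNReal.ofReal β * (3 * ∑' t, ENNReal.ofReal β ^ (t + N) *
      D.totalMoment (t + N + 1) z) = D.tailMoment β (N + 1) z := by
    rw [tailMoment, mul_left_comm, ← ENNReal.tsum_mul_left]
    congr 2
    ext t
    rw [← add_assoc t N 1, pow_succ']
    ring
  rw [← h2, hcon, ENNReal.mul_top (ENNReal.ofReal_pos.2 hβ).ne'] at h
  exact h rfl

theorem integral_payoff_le {β : ℝ} (hβ : β ∈ Set.Ioo (0 : ℝ) 1)
    (hsum : ∀ z, ∑' t, ENNReal.ofReal β ^ t * D.totalMoment t z ≠ ∞)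
    {τ : (ℕ → Z) → WithTop ℕ} (hτ : τ ∈ D.stoppingTimes) (N : ℕ) (z : Z) :
    ∫ ω, D.payoff β ω ((τ ω).untopD 0) ∂(D.pathLaw z) ≤
      D.finiteHorizonValue β N z + (D.tailMoment β N z).toReal := by
  have hfin : ∀ t z, D.totalMoment t z ≠ ∞ := fun t z => totalMoment_ne_top_of_tsum hβ.1 (hsum z) t
  have hint : ∀ M, Integrable (fun ω => D.payoff β ω (stopIndex τ M ω)) (D.pathLaw z) := fun M =>
    integrable_stopped (F := fun k ω => D.payoff β ω k) hτ.1
      fun s _ => D.integrable_payoff hfin β s z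
  have hmin : ∀ᵐ ω ∂(D.pathLaw z), ∀ M, stopIndex τ M ω = min ((τ ω).untopD 0) M := by
    filter_upwards [hτ.2 z] with ω hω M
    lift τ ω to ℕ using hω with k hk
    rw [stopIndex, ← hk]
    rfl
  -- Almost surely `τ` is finite, so the truncated payoffs are eventually equal to the full one.
  have hmeas : AEStronglyMeasurable (fun ω => D.payoff β ω ((τ ω).untopD 0)) (D.pathLaw z) := by
    refine aestronglyMeasurable_of_tendsto_ae atTop (fun M => (hint M).aestronglyMeasurable) ?_
    filter_upwards [hmin] with ω hω
    refine tendsto_const_nhds.congr' ?_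
    filter_upwards [eventually_ge_atTop ((τ ω).untopD 0)] with M hM
    rw [hω M, min_eq_left hM]
  have hbound : ∫⁻ ω, ‖D.payoff β ω ((τ ω).untopD 0) - D.payoff β ω (stopIndex τ N ω)‖ₑ
      ∂(D.pathLaw z) ≤ D.tailMoment β N z := by
    rw [← lintegral_tail_pathLaw]
    refine lintegral_mono_ae ?_
    filter_upwards [hmin] with ω hω
    rw [hω N, Real.enorm_eq_ofReal_abs]
    exact D.ofReal_abs_payoff_sub_le hβ.1.le N _ ω
  have hdiff : Integrable (fun ω => D.payoff β ω ((τ ω).untopD 0) -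
      D.payoff β ω (stopIndex τ N ω)) (D.pathLaw z) :=
    ⟨hmeas.sub (hint N).aestronglyMeasurable, hbound.trans_lt (tailMoment_ne_top (hsum z) N).lt_top⟩
  have hsplit : ∫ ω, D.payoff β ω ((τ ω).untopD 0) ∂(D.pathLaw z) =
      ∫ ω, D.payoff β ω (stopIndex τ N ω) ∂(D.pathLaw z) +
        ∫ ω, (D.payoff β ω ((τ ω).untopD 0) - D.payoff β ω (stopIndex τ N ω)) ∂(D.pathLaw z) := by
    rw [← integral_add (hint N) hdiff]
    simp
  rw [hsplit]
  refine add_le_add (D.integral_payoff_stopIndex_le hfin hβ N z hτ.1) ?_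
  refine (le_abs_self _).trans ?_
  rw [← Real.norm_eq_abs, ← toReal_enorm]
  exact ENNReal.toReal_mono (tailMoment_ne_top (hsum z) N)
    ((enorm_integral_le_lintegral_enorm _).trans hbound)

theorem finiteHorizonValue_le_value {β : ℝ} (hβ : β ∈ Set.Ioo (0 : ℝ) 1)
    (hsum : ∀ z, ∑' t, ENNReal.ofReal β ^ t * D.totalMoment t z ≠ ∞) (N : ℕ) (z : Z) :
    D.finiteHorizonValue β N z ≤ D.value β z := by
  rw [← D.integral_payoff_greedyTime (fun t z => totalMoment_ne_top_of_tsum hβ.1 (hsum z) t) hβ]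
  -- The horizon 0 estimate bounds the set of payoffs above, so the real supremum is a genuine one.
  refine le_csSup ⟨D.finiteHorizonValue β 0 z + (D.tailMoment β 0 z).toReal, ?_⟩
    ⟨_, D.greedyTime_mem_stoppingTimes β N, rfl⟩
  rintro _ ⟨τ, hτ, rfl⟩
  exact integral_payoff_le hβ hsum hτ 0 z

theorem value_le {β : ℝ} (hβ : β ∈ Set.Ioo (0 : ℝ) 1)
    (hsum : ∀ z, ∑' t, ENNReal.ofReal β ^ t * D.totalMoment t z ≠ ∞) (N : ℕ) (z : Z) :
    D.value β z ≤ D.finiteHorizonValue β N z + (D.tailMoment β N z).toReal := by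
  refine csSup_le ⟨_, ⟨_, D.greedyTime_mem_stoppingTimes β N, rfl⟩⟩ ?_
  rintro _ ⟨τ, hτ, rfl⟩
  exact integral_payoff_le hβ hsum hτ N z

/-- A supremum over a possibly uncountable family of stopping times, but also the pointwise limit of
the measurable finite horizon values. -/
theorem measurable_value {β : ℝ} (hβ : β ∈ Set.Ioo (0 : ℝ) 1)
    (hsum : ∀ z, ∑' t, ENNReal.ofReal β ^ t * D.totalMoment t z ≠ ∞) :
    Measurable (D.value β) := by
  refine measurable_of_tendsto_metrizable (fun N => D.measurable_finiteHorizonValue β N)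
    (tendsto_pi_nhds.2 fun z => ?_)
  have h0 : Tendsto (fun N => (D.tailMoment β N z).toReal) atTop (𝓝 0) :=
    (ENNReal.tendsto_toReal_zero_iff fun N => tailMoment_ne_top (hsum z) N).2
      (tendsto_tailMoment (hsum z))
  have h1 : Tendsto (fun N => D.value β z - (D.tailMoment β N z).toReal) atTop
      (𝓝 (D.value β z)) := by
    simpa using tendsto_const_nhds.sub h0
  refine tendsto_of_tendsto_of_tendsto_of_le_of_le h1 tendsto_const_nhds (fun N => ?_) fun N =>
    finiteHorizonValue_le_value hβ hsum N z
  linarith [value_le hβ hsum N z]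

variable (D) in
/-- The continuation value when the problem has horizon `N + 1`. -/
def finiteHorizonContValue (β : ℝ) (N : ℕ) (z : Z) : ℝ :=
  D.c z + β * ∫ z', D.finiteHorizonValue β N z' ∂(D.P z)

theorem abs_contValue_sub_le {β : ℝ} (hβ : β ∈ Set.Ioo (0 : ℝ) 1)
    (hsum : ∀ z, ∑' t, ENNReal.ofReal β ^ t * D.totalMoment t z ≠ ∞) (N : ℕ) (z : Z) :
    |D.contValue β z - D.finiteHorizonContValue β N z| ≤
      (3 * ∑' t, ENNReal.ofReal β ^ (t + N) * D.totalMoment (t + N + 1) z).toReal := by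
  have hfin : ∀ t z, D.totalMoment t z ≠ ∞ := fun t z => totalMoment_ne_top_of_tsum hβ.1 (hsum z) t
  have hvi := D.integrable_finiteHorizonValue hfin hβ N z
  have hbound : ∫⁻ z', ‖D.value β z' - D.finiteHorizonValue β N z'‖ₑ ∂(D.P z) ≤
      ∫⁻ z', D.tailMoment β N z' ∂(D.P z) := by
    refine lintegral_mono fun z' => ?_
    rw [Real.enorm_eq_ofReal_abs, abs_of_nonneg
      (sub_nonneg.2 (finiteHorizonValue_le_value hβ hsum N z'))]
    refine ENNReal.ofReal_le_of_le_toReal ?_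
    linarith [value_le hβ hsum N z']
  have hne := lintegral_tailMoment_ne_top hβ.1 (hsum z) N
  have hdi : Integrable (fun z' => D.value β z' - D.finiteHorizonValue β N z') (D.P z) :=
    ⟨((measurable_value hβ hsum).sub (D.measurable_finiteHorizonValue β N)).aestronglyMeasurable,
      hbound.trans_lt hne.lt_top⟩
  have hsplit : ∫ z', D.value β z' ∂(D.P z) = ∫ z', D.finiteHorizonValue β N z' ∂(D.P z) +
      ∫ z', (D.value β z' - D.finiteHorizonValue β N z') ∂(D.P z) := by
    rw [← integral_add hvi hdi]
    simp
  have heq : D.contValue β z - D.finiteHorizonContValue β N z =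
      β * ∫ z', (D.value β z' - D.finiteHorizonValue β N z') ∂(D.P z) := by
    rw [contValue, finiteHorizonContValue, hsplit]
    ring
  rw [heq, abs_mul, abs_of_pos hβ.1, ← lintegral_tailMoment]
  refine (mul_le_of_le_one_left (abs_nonneg _) hβ.2.le).trans ?_
  rw [← Real.norm_eq_abs, ← toReal_enorm]
  exact ENNReal.toReal_mono hne ((enorm_integral_le_lintegral_enorm _).trans hbound)

/-! ### Consequences of the drift condition -/

/-- Iterating the drift gives a geometric sum; since `M ≥ 1`, it is at most `s M^s`. The polynomial
factor is harmless once `β M < 1`. -/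
theorem Drift.lintegral_pow_le {β : ℝ} {g : Z → ℝ≥0} {n : ℕ} {m d M d₁ : ℝ≥0}
    (h : D.Drift β g n m d) (hm : m ≤ M) (hM : 1 ≤ M) (hd : d ≤ d₁) (s : ℕ) (z : Z) :
    ∫⁻ z', (g z' : ℝ≥0∞) ∂((D.P ^ s) z) ≤ (M : ℝ≥0∞) ^ s * (g z + d₁ * s) := by
  have hg : Measurable fun z => (g z : ℝ≥0∞) := h.measurable_g.coe_nnreal_ennreal
  induction s generalizing z with
  | zero =>
    rw [D.lintegral_pow_zero z hg]
    simp
  | succ s ih =>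
    have hM' : (1 : ℝ≥0∞) ≤ M := by exact_mod_cast hM
    rw [D.lintegral_pow_succ' s z hg]
    calc ∫⁻ z', ∫⁻ z'', (g z'' : ℝ≥0∞) ∂((D.P ^ s) z') ∂(D.P z)
        ≤ ∫⁻ z', (M : ℝ≥0∞) ^ s * (g z' + d₁ * s) ∂(D.P z) := lintegral_mono fun z' => ih z'
      _ = (M : ℝ≥0∞) ^ s * (∫⁻ z', (g z' : ℝ≥0∞) ∂(D.P z) + d₁ * s) := by
          rw [lintegral_const_mul _ (by fun_prop), lintegral_add_left hg]
          simp
      _ ≤ (M : ℝ≥0∞) ^ s * ((M * g z + M * d₁) + M * (d₁ * s)) := by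
          gcongr (M : ℝ≥0∞) ^ s * (?_ + ?_)
          · refine (h.drift z).trans ?_
            gcongr
            calc (d : ℝ≥0∞) ≤ d₁ := by exact_mod_cast hd
              _ = 1 * d₁ := (one_mul _).symm
              _ ≤ M * d₁ := by gcongr
          · calc (d₁ : ℝ≥0∞) * s = 1 * (d₁ * s) := (one_mul _).symm
              _ ≤ M * (d₁ * s) := by gcongr
      _ = (M : ℝ≥0∞) ^ (s + 1) * (g z + d₁ * (s + 1 : ℕ)) := by
          push_cast
          ring

theorem Drift.absMoment_le {β : ℝ} {g : Z → ℝ≥0} {n : ℕ} {m d M d₁ : ℝ≥0}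
    (h : D.Drift β g n m d) (hm : m ≤ M) (hM : 1 ≤ M) (hd : d ≤ d₁) {f : Z → ℝ}
    (hf : Measurable f) (hfg : ∀ z, D.absMoment f n z ≤ g z) {t : ℕ} (ht : n ≤ t) (z : Z) :
    D.absMoment f t z ≤ (M : ℝ≥0∞) ^ t * (g z + d₁ * t) := by
  obtain ⟨s, rfl⟩ := Nat.exists_eq_add_of_le' ht
  have hM' : (1 : ℝ≥0∞) ≤ M := by exact_mod_cast hM
  rw [← lintegral_absMoment D hf]
  calc ∫⁻ z', D.absMoment f n z' ∂((D.P ^ s) z)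
      ≤ ∫⁻ z', (g z' : ℝ≥0∞) ∂((D.P ^ s) z) := lintegral_mono hfg
    _ ≤ (M : ℝ≥0∞) ^ s * (g z + d₁ * s) := h.lintegral_pow_le hm hM hd s z
    _ ≤ _ := by
      gcongr
      · exact Nat.le_add_right s n
      · exact Nat.le_add_right s n

end SingleProblem

end StoppingProblem

/-! ### Convergence of integrals of unbounded functions under weak convergence -/

section WeakConvergence

variable {Ω : Type*} [MeasurableSpace Ω] [TopologicalSpace Ω] [OpensMeasurableSpace Ω]
  [HasOuterApproxClosed Ω] {μ : ProbabilityMeasure Ω} {μs : ℕ → ProbabilityMeasure Ω}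

/-- Fatou's lemma for weak convergence, via the portmanteau inequality on open sets. Negative `a` is
treated apart because `ENNReal.ofReal` truncates it. -/
theorem eventually_lt_integral_of_tendsto (hμ : Tendsto μs atTop (𝓝 μ)) {F : Ω → ℝ}
    (hF : Continuous F) (hF0 : 0 ≤ F) (hi : Integrable F μ) (his : ∀ i, Integrable F (μs i))
    {a : ℝ} (ha : a < ∫ x, F x ∂μ) : ∀ᶠ i in atTop, a < ∫ x, F x ∂(μs i) := by
  rcases lt_or_ge a 0 with h | h
  · exact Eventually.of_forall fun i => h.trans_le (integral_nonneg hF0)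
  have hl := lintegral_le_liminf_lintegral_of_forall_isOpen_measure_le_liminf_measure
    (μ := (μ : Measure Ω)) (μs := fun i => (μs i : Measure Ω)) hF hF0
    fun G hG => ProbabilityMeasure.le_liminf_measure_open_of_tendsto hμ hG
  rw [← ofReal_integral_eq_lintegral_ofReal hi (Eventually.of_forall hF0)] at hl
  have hlt : ENNReal.ofReal a < ENNReal.ofReal (∫ x, F x ∂μ) :=
    (ENNReal.ofReal_lt_ofReal_iff (h.trans_lt ha)).2 ha
  filter_upwards [eventually_lt_of_lt_liminf (hlt.trans_le hl)] with i hi'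
  rw [← ofReal_integral_eq_lintegral_ofReal (his i) (Eventually.of_forall hF0)] at hi'
  exact (ENNReal.ofReal_lt_ofReal_iff_of_nonneg h).1 hi'

/-- Fatou is applied to the nonnegative functions `H + f` and `H - f`; convergence of `∫ H` then
removes `H`. -/
theorem tendsto_integral_of_abs_le (hμ : Tendsto μs atTop (𝓝 μ)) {f H : Ω → ℝ}
    (hf : Continuous f) (hH : Continuous H) (hfH : ∀ x, |f x| ≤ H x) (hi : Integrable H μ)
    (his : ∀ i, Integrable H (μs i))
    (hlim : Tendsto (fun i => ∫ x, H x ∂(μs i)) atTop (𝓝 (∫ x, H x ∂μ))) :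
    Tendsto (fun i => ∫ x, f x ∂(μs i)) atTop (𝓝 (∫ x, f x ∂μ)) := by
  have hdom : ∀ {h : Ω → ℝ}, Continuous h → (∀ x, |h x| ≤ H x) → ∀ {ν : Measure Ω},
      Integrable H ν → Integrable h ν := fun hh hle _ hν =>
    hν.mono' hh.measurable.aestronglyMeasurable (Eventually.of_forall hle)
  have key : ∀ {h : Ω → ℝ}, Continuous h → (∀ x, |h x| ≤ H x) → ∀ a < ∫ x, h x ∂μ,
      ∀ᶠ i in atTop, a < ∫ x, h x ∂(μs i) := by
    intro h hh hle a ha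
    have hi1 := hdom hh hle hi
    have hi2 : ∀ i, Integrable h (μs i) := fun i => hdom hh hle (his i)
    -- The slack `∫ h - a` is halved: one half for the Fatou bound, the other for the fluctuation of
    -- `∫ H`.
    have h1 : (a + ∫ x, h x ∂μ) / 2 + ∫ x, H x ∂μ < ∫ x, (h x + H x) ∂μ := by
      rw [integral_add hi1 hi]
      linarith
    have h2 : ∀ᶠ i in atTop, ∫ x, H x ∂(μs i) < ∫ x, H x ∂μ + (∫ x, h x ∂μ - a) / 2 :=
      hlim.eventually_lt_const (by linarith)
    filter_upwards [h2, eventually_lt_integral_of_tendsto (F := fun x => h x + H x) hμ (hh.add hH)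
      (fun x => by have := neg_le_of_abs_le (hle x); simp only [Pi.zero_apply]; linarith)
      (hi1.add hi) (fun i => (hi2 i).add (his i)) h1] with i h3 h4
    rw [integral_add (hi2 i) (his i)] at h4
    linarith
  refine tendsto_order.2 ⟨key hf hfH, fun b hb => ?_⟩
  have := key (h := fun x => -f x) hf.neg (fun x => by rw [abs_neg]; exact hfH x) (-b)
    (by rw [integral_neg]; linarith)
  filter_upwards [this] with i hi'
  rw [integral_neg] at hi'
  linarith

end WeakConvergence

theorem FiniteContinuous.add {A : Type*} [TopologicalSpace A] {f g : A → ℝ≥0∞}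
    (hf : FiniteContinuous f) (hg : FiniteContinuous g) : FiniteContinuous fun a => f a + g a := by
  refine ⟨fun a => ENNReal.add_ne_top.2 ⟨hf.1 a, hg.1 a⟩, ?_⟩
  simp_rw [ENNReal.toReal_add (hf.1 _) (hg.1 _)]
  exact hf.2.add hg.2

theorem FiniteContinuous.const_mul {A : Type*} [TopologicalSpace A] {f : A → ℝ≥0∞}
    (hf : FiniteContinuous f) (C : ℝ≥0) : FiniteContinuous fun a => C * f a := by
  refine ⟨fun a => ENNReal.mul_ne_top ENNReal.coe_ne_top (hf.1 a), ?_⟩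
  simp_rw [ENNReal.toReal_mul]
  exact hf.2.const_mul _

/-! ### Parametric integrals under the Feller property -/

section Parametric

variable {Z Θ : Type*} [MeasurableSpace Z] [PseudoMetricSpace Z] [BorelSpace Z]
  [MeasurableSpace Θ] [PseudoMetricSpace Θ] [SecondCountableTopology Θ] [BorelSpace Θ]
  {D : Θ → StoppingProblem Z}

/-- The joint law of the next state and the parameter. -/
def jointLaw (D : Θ → StoppingProblem Z) (p : Z × Θ) : ProbabilityMeasure (Z × Θ) :=
  ⟨((D p.2).P p.1).map fun z => (z, p.2), Measure.isProbabilityMeasure_map (by fun_prop)⟩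

theorem integral_jointLaw (p : Z × Θ) {f : Z × Θ → ℝ} (hf : Continuous f) :
    ∫ x, f x ∂(jointLaw D p : Measure (Z × Θ)) = ∫ z, f (z, p.2) ∂((D p.2).P p.1) :=
  integral_map (by fun_prop) hf.measurable.aestronglyMeasurable

/-- On bounded Lipschitz test functions, changing the parameter inside the integrand costs at most
`L` times the distance; with it frozen, the Feller property applies. -/
theorem continuous_jointLaw (hD : ParamFeller D) : Continuous (jointLaw D) := by
  rw [continuous_iff_continuousAt]
  intro p
  refine tendsto_iff_forall_lipschitz_integral_tendsto.2 fun f hb hL => ?_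
  obtain ⟨C, hC⟩ := hb
  obtain ⟨L, hL⟩ := hL
  simp_rw [integral_jointLaw _ hL.continuous]
  have hcont : ∀ θ : Θ, Continuous fun z => f (z, θ) := fun θ => hL.continuous.comp (by fun_prop)
  let F : Θ → (Z →ᵇ ℝ) := fun θ => BoundedContinuousFunction.mkOfBound ⟨_, hcont θ⟩ C
    fun x y => hC _ _
  have hFi : ∀ (θ : Θ) (q : Z × Θ), Integrable (fun z => f (z, θ)) ((D q.2).P q.1) :=
    fun θ q => (F θ).integrable _
  have h1 : Tendsto (fun q : Z × Θ => ∫ z, f (z, p.2) ∂((D q.2).P q.1)) (𝓝 p)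
    (𝓝 (∫ z, f (z, p.2) ∂((D p.2).P p.1))) := (hD (F p.2)).tendsto p
  have h2 : Tendsto (fun q : Z × Θ => ∫ z, f (z, q.2) ∂((D q.2).P q.1) -
      ∫ z, f (z, p.2) ∂((D q.2).P q.1)) (𝓝 p) (𝓝 0) := by
    have h3 : Tendsto (fun q : Z × Θ => (L : ℝ) * dist q.2 p.2) (𝓝 p) (𝓝 0) := by
      have : Continuous fun q : Z × Θ => (L : ℝ) * dist q.2 p.2 := by fun_prop
      simpa using this.tendsto p
    refine squeeze_zero_norm (fun q => ?_) h3
    rw [← integral_sub (hFi _ _) (hFi _ _)]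
    refine (norm_integral_le_of_norm_le_const (C := (L : ℝ) * dist q.2 p.2)
      (Eventually.of_forall fun z => ?_)).trans (by simp)
    have := hL.dist_le_mul (z, q.2) (z, p.2)
    rwa [Prod.dist_eq, dist_self, max_eq_right dist_nonneg] at this
  simpa using h2.add h1

/-- Both integrand and kernel vary with `θ`. Passing to the joint law on `Z × Θ` makes the integrand
fixed and leaves only weak convergence of laws. -/
theorem continuous_integral_of_abs_le (hD : ParamFeller D) {f H : Z × Θ → ℝ} (hf : Continuous f)
    (hH : Continuous H) (hfH : ∀ x, |f x| ≤ H x)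
    (hP : FiniteContinuous fun p : Z × Θ =>
      ∫⁻ z', ENNReal.ofReal (H (z', p.2)) ∂((D p.2).P p.1)) :
    Continuous fun p : Z × Θ => ∫ z', f (z', p.2) ∂((D p.2).P p.1) := by
  have hH0 : ∀ x, 0 ≤ H x := fun x => (abs_nonneg _).trans (hfH x)
  have hint : ∀ p, Integrable H (jointLaw D p : Measure (Z × Θ)) := by
    intro p
    refine (integrable_map_measure hH.measurable.aestronglyMeasurable (by fun_prop)).2
      ⟨(hH.comp (by fun_prop)).measurable.aestronglyMeasurable, ?_⟩
    refine (hasFiniteIntegral_iff_ofReal (Eventually.of_forall fun z => hH0 _)).2 ?_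
    exact (hP.1 p).lt_top
  have hHint : ∀ p, ∫ x, H x ∂(jointLaw D p : Measure (Z × Θ)) =
      (∫⁻ z', ENNReal.ofReal (H (z', p.2)) ∂((D p.2).P p.1)).toReal := by
    intro p
    rw [integral_jointLaw p hH, integral_eq_lintegral_of_nonneg_ae
      (Eventually.of_forall fun z => hH0 _)
      (hH.comp (by fun_prop)).measurable.aestronglyMeasurable]
  refine continuous_iff_seqContinuous.2 fun u p hu => ?_
  simp only [Function.comp_def, ← integral_jointLaw _ hf]
  refine tendsto_integral_of_abs_le (((continuous_jointLaw hD).tendsto p).comp hu) hf hH hfH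
    (hint p) (fun i => hint _) ?_
  simp only [Function.comp_def, hHint]
  exact (hP.2.tendsto p).comp hu

end Parametric

/-! ### Moment bounds by the weight function -/

namespace StoppingProblem

variable {Z : Type*} [MeasurableSpace Z] {D : StoppingProblem Z}

/-- The factor in the bound of the `t`-th moments by the weight function. -/
def momentFactor (M d m' d' : ℝ≥0) (t : ℕ) : ℝ≥0 := m'⁻¹ + M ^ t * (1 + d / d' * t)

theorem le_weight_g (g : Z → ℝ≥0) (n : ℕ) (m' d' : ℝ≥0) (z : Z) :
    (g z : ℝ≥0∞) ≤ D.weight g n m' d' z := by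
  rw [weight, add_assoc]
  exact le_add_left le_self_add

/-- For `t < n` the moment is a summand of the weight, up to `1 / m'`. For `t ≥ n` the drift bound
applies, with `g ≤ ℓ` and `d = (d / d') d' ≤ (d / d') ℓ`. The factor adds the two cases. -/
theorem le_momentFactor_mul_weight {g : Z → ℝ≥0} {n : ℕ} {M d m' d' : ℝ≥0} (hm' : 0 < m')
    (hd' : 0 < d') {f : Z → ℝ} {t : ℕ} {z : Z}
    (hlt : t < n → m' * D.absMoment f t z ≤ D.weight g n m' d' z)
    (hge : n ≤ t → D.absMoment f t z ≤ (M : ℝ≥0∞) ^ t * (g z + d * t)) :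
    D.absMoment f t z ≤ momentFactor M d m' d' t * D.weight g n m' d' z := by
  set ℓ := D.weight g n m' d' z with hℓ
  rw [momentFactor, ENNReal.coe_add, add_mul]
  rcases lt_or_ge t n with h | h
  · refine le_add_right ?_
    rw [ENNReal.coe_inv hm'.ne']
    calc D.absMoment f t z = (m' : ℝ≥0∞)⁻¹ * (m' * D.absMoment f t z) := by
          rw [← mul_assoc, ENNReal.inv_mul_cancel (by exact_mod_cast hm'.ne') ENNReal.coe_ne_top,
            one_mul]
      _ ≤ _ := by gcongr; exact hlt h
  · refine le_add_left ((hge h).trans ?_)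
    have hg : (g z : ℝ≥0∞) ≤ ℓ := le_weight_g g n m' d' z
    have hd : (d' : ℝ≥0∞) ≤ ℓ := le_add_self
    have hd2 : (d : ℝ≥0∞) ≤ (d / d' : ℝ≥0) * ℓ := by
      calc (d : ℝ≥0∞) = (d / d' : ℝ≥0) * (d' : ℝ≥0∞) := by
            rw [← ENNReal.coe_mul, div_mul_cancel₀ _ hd'.ne']
        _ ≤ _ := by gcongr
    calc (M : ℝ≥0∞) ^ t * (g z + d * t)
        ≤ (M : ℝ≥0∞) ^ t * (ℓ + (d / d' : ℝ≥0) * ℓ * t) := by gcongr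
      _ = _ := by
        push_cast
        ring

variable {β : ℝ} {g : Z → ℝ≥0} {n₀ n : ℕ} {m d M d₁ m' d' : ℝ≥0}

theorem Drift.absMoment_c_le_weight (h : D.Drift β g n₀ m d) (hn : n₀ ≤ n) (hm : m ≤ M)
    (hM : 1 ≤ M) (hd : d ≤ d₁) (hm' : 0 < m') (hd' : 0 < d') (t : ℕ) (z : Z) :
    D.absMoment D.c t z ≤ momentFactor M d₁ m' d' t * D.weight g n m' d' z := by
  refine le_momentFactor_mul_weight hm' hd' (fun ht => ?_) fun ht =>
    h.absMoment_le hm hM hd D.measurable_c h.flow_le (hn.trans ht) z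
  rw [weight, add_assoc]
  refine le_add_right (mul_le_mul_right (le_add_left ?_) _)
  exact Finset.single_le_sum (f := fun t => D.absMoment D.c t z) (fun _ _ => zero_le)
    (Finset.mem_range.2 ht)

theorem Drift.absMoment_r_le_weight (h : D.Drift β g n₀ m d) (hn : n₀ ≤ n) (hm : m ≤ M)
    (hM : 1 ≤ M) (hd : d ≤ d₁) (hm' : 0 < m') (hd' : 0 < d') (t : ℕ) (z : Z) :
    D.absMoment D.r (t + 1) z ≤ momentFactor M d₁ m' d' (t + 1) * D.weight g n m' d' z := by
  refine le_momentFactor_mul_weight hm' hd' (fun ht => ?_) fun ht =>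
    h.absMoment_le hm hM hd D.measurable_r h.exit_le (hn.trans ht) z
  rw [weight, add_assoc]
  refine le_add_right (mul_le_mul_right (le_add_right ?_) _)
  exact Finset.single_le_sum (f := fun t => D.absMoment D.r t z) (fun _ _ => zero_le)
    (Finset.mem_Ico.2 ⟨t.succ_pos, ht⟩)

theorem Drift.totalMoment_le_weight (h : D.Drift β g n₀ m d) (hn : n₀ ≤ n) (hm : m ≤ M)
    (hM : 1 ≤ M) (hd : d ≤ d₁) (hm' : 0 < m') (hd' : 0 < d') (t : ℕ) (z : Z) :
    D.totalMoment (t + 1) z ≤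
      (2 * momentFactor M d₁ m' d' (t + 1) : ℝ≥0) * D.weight g n m' d' z := by
  rw [two_mul, ENNReal.coe_add, add_mul]
  exact add_le_add (h.absMoment_r_le_weight hn hm hM hd hm' hd' t z)
    (h.absMoment_c_le_weight hn hm hM hd hm' hd' (t + 1) z)

theorem summable_momentFactor {β : ℝ≥0} (hβ : β < 1) (hβM : β * M < 1) (d₁ m' d' : ℝ≥0) :
    Summable fun t => β ^ t * (2 * momentFactor M d₁ m' d' (t + 1)) := by
  have h1 : Summable fun t : ℕ => (β : ℝ) ^ t := summable_geometric_of_lt_one β.2 hβ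
  have hβM' : (β : ℝ) * M < 1 := by exact_mod_cast hβM
  have h2 : Summable fun t : ℕ => ((β : ℝ) * M) ^ t :=
    summable_geometric_of_lt_one (by positivity) hβM'
  have h3 : Summable fun t : ℕ => (t : ℝ) ^ 1 * ((β : ℝ) * M) ^ t :=
    summable_pow_mul_geometric_of_norm_lt_one 1 (by
      rw [Real.norm_of_nonneg (by positivity)]
      exact hβM')
  rw [← NNReal.summable_coe]
  refine (((h1.mul_left (2 * (m' : ℝ)⁻¹)).add
    (h2.mul_left (2 * (M : ℝ) * (1 + (d₁ : ℝ) / d')))).add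
    (h3.mul_left (2 * (M : ℝ) * ((d₁ : ℝ) / d')))).congr fun t => ?_
  simp only [momentFactor]
  push_cast
  rw [mul_pow]
  ring

theorem totalMoment_zero_ne_top (D : StoppingProblem Z) (z : Z) : D.totalMoment 0 z ≠ ∞ := by
  rw [totalMoment, absMoment_zero D D.measurable_r, absMoment_zero D D.measurable_c]
  exact ENNReal.add_ne_top.2 ⟨ENNReal.ofReal_ne_top, ENNReal.ofReal_ne_top⟩

theorem tsum_totalMoment_ne_top {b : ℝ≥0} {K : ℕ → ℝ≥0} {ℓ : ℝ≥0∞} {z : Z} (hℓ : ℓ ≠ ∞)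
    (hK : ∀ t, D.totalMoment (t + 1) z ≤ K t * ℓ) (hs : Summable fun t => b ^ t * K t) :
    ∑' t, (b : ℝ≥0∞) ^ t * D.totalMoment t z ≠ ∞ := by
  rw [tsum_eq_zero_add' ENNReal.summable]
  refine ENNReal.add_ne_top.2 ⟨?_, ?_⟩
  · rw [pow_zero, one_mul]
    exact D.totalMoment_zero_ne_top z
  have hle : ∑' t, (b : ℝ≥0∞) ^ (t + 1) * D.totalMoment (t + 1) z ≤
      b * ((∑' t, ((b ^ t * K t : ℝ≥0) : ℝ≥0∞)) * ℓ) := by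
    rw [← ENNReal.tsum_mul_right, ← ENNReal.tsum_mul_left]
    refine ENNReal.tsum_le_tsum fun t => ?_
    calc (b : ℝ≥0∞) ^ (t + 1) * D.totalMoment (t + 1) z ≤ (b : ℝ≥0∞) ^ (t + 1) * (K t * ℓ) := by
          gcongr
          exact hK t
      _ = _ := by
        push_cast
        ring
  exact ne_top_of_le_ne_top (ENNReal.mul_ne_top ENNReal.coe_ne_top
    (ENNReal.mul_ne_top (ENNReal.tsum_coe_ne_top_iff_summable.2 hs) hℓ)) hle

end StoppingProblem

open StoppingProblem

/-! ### Joint continuity of the continuation value -/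

section Parametric

variable {Z Θ : Type*} [MeasurableSpace Z] [PseudoMetricSpace Z]
  [BorelSpace Z] [MeasurableSpace Θ] [PseudoMetricSpace Θ] [SecondCountableTopology Θ]
  [BorelSpace Θ]
  {D : Θ → StoppingProblem Z} {β : ℝ} {g : Θ → Z → ℝ≥0} {n : Θ → ℕ}
  {m' d' : ℝ≥0} {K : ℕ → ℝ≥0}

theorem continuous_finiteHorizonContValue_of_continuous (hβ : β ∈ Set.Ioo (0 : ℝ) 1)
    (hfeller : ParamFeller D) (hcont : ParamCont D g n m' d')
    (hc : ∀ θ z, (D θ).absMoment (D θ).c 0 z ≤ K 0 * paramWeight D g n m' d' z θ)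
    (hK : ∀ θ t z, (D θ).totalMoment (t + 1) z ≤ K (t + 1) * paramWeight D g n m' d' z θ) {N : ℕ}
    (hN : Continuous fun p : Z × Θ => (D p.2).finiteHorizonValue β N p.1) :
    Continuous fun p : Z × Θ => (D p.2).finiteHorizonContValue β N p.1 := by
  set C : ℝ≥0 := ∑ t ∈ Finset.range (N + 1), K t with hC
  let H : Z × Θ → ℝ := fun p => |(D p.2).r p.1| + C * (paramWeight D g n m' d' p.1 p.2).toReal
  have hH0 : ∀ p, ENNReal.ofReal (H p) =
      ENNReal.ofReal |(D p.2).r p.1| + C * paramWeight D g n m' d' p.1 p.2 := by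
    intro p
    rw [ENNReal.ofReal_add (abs_nonneg _) (by positivity), ENNReal.ofReal_mul (NNReal.coe_nonneg C),
      ENNReal.ofReal_toReal (hcont.cont_weight.1 p)]
    simp
  have hH : Continuous H := by
    have h1 := hcont.cont_r
    have h2 := hcont.cont_weight.2
    exact h1.abs.add (h2.const_mul _)
  have hfH : ∀ p : Z × Θ, |(D p.2).finiteHorizonValue β N p.1| ≤ H p := by
    intro p
    refine (ENNReal.ofReal_le_ofReal_iff (by positivity)).1 ?_
    refine ((D p.2).ofReal_abs_finiteHorizonValue_le hβ N p.1).trans ?_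
    rw [hH0, hC, add_assoc, Finset.sum_range_succ', ENNReal.coe_add, add_mul,
      ENNReal.ofNNReal_finsetSum, Finset.sum_mul]
    refine add_le_add le_rfl ?_
    rw [add_comm]
    exact add_le_add (Finset.sum_le_sum fun t _ => hK p.2 t p.1) (hc p.2 p.1)
  have hint := continuous_integral_of_abs_le hfeller hN hH hfH (by
    have h1 := hcont.cont_int_r.add (hcont.cont_int_weight.const_mul C)
    convert h1 using 2 with p
    have hr := (D p.2).measurable_r
    simp_rw [hH0]
    rw [lintegral_add_left (by fun_prop), lintegral_const_mul' _ _ ENNReal.coe_ne_top])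
  exact hcont.cont_c.add (hint.const_mul β)

theorem continuous_finiteHorizonValue (hβ : β ∈ Set.Ioo (0 : ℝ) 1)
    (hfeller : ParamFeller D) (hcont : ParamCont D g n m' d')
    (hc : ∀ θ z, (D θ).absMoment (D θ).c 0 z ≤ K 0 * paramWeight D g n m' d' z θ)
    (hK : ∀ θ t z, (D θ).totalMoment (t + 1) z ≤ K (t + 1) * paramWeight D g n m' d' z θ) (N : ℕ) :
    Continuous fun p : Z × Θ => (D p.2).finiteHorizonValue β N p.1 := by
  induction N with
  | zero => exact hcont.cont_r
  | succ N ih =>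
    exact hcont.cont_r.max
      (continuous_finiteHorizonContValue_of_continuous hβ hfeller hcont hc hK ih)

theorem continuous_contValue_of_bounds (hβ : β ∈ Set.Ioo (0 : ℝ) 1)
    (hfeller : ParamFeller D) (hcont : ParamCont D g n m' d')
    (hc : ∀ θ z, (D θ).absMoment (D θ).c 0 z ≤ K 0 * paramWeight D g n m' d' z θ)
    (hK : ∀ θ t z, (D θ).totalMoment (t + 1) z ≤ K (t + 1) * paramWeight D g n m' d' z θ)
    (hs : Summable fun t => β.toNNReal ^ t * K (t + 1)) :
    Continuous fun p : Z × Θ => (D p.2).contValue β p.1 := by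
  set a : ℕ → ℝ := fun N => 3 * ∑' t, ((β.toNNReal ^ (t + N) * K (t + N + 1) : ℝ≥0) : ℝ) with ha
  have ha0 : Tendsto a atTop (𝓝 0) := by
    have h := tendsto_sum_nat_add fun t => ((β.toNNReal ^ t * K (t + 1) : ℝ≥0) : ℝ)
    have h3 := h.const_mul 3
    rw [mul_zero] at h3
    exact h3
  have hbound : ∀ N (p : Z × Θ),
      |(D p.2).contValue β p.1 - (D p.2).finiteHorizonContValue β N p.1| ≤
      a N * (paramWeight D g n m' d' p.1 p.2).toReal := by
    intro N p
    have hsN : Summable fun t => β.toNNReal ^ (t + N) * K (t + N + 1) :=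
      NNReal.summable_nat_add _ hs N
    refine (abs_contValue_sub_le hβ (fun z => tsum_totalMoment_ne_top
      (hcont.cont_weight.1 (z, p.2)) (fun t => hK p.2 t z) hs) N p.1).trans ?_
    have hle : 3 * ∑' t, ENNReal.ofReal β ^ (t + N) * (D p.2).totalMoment (t + N + 1) p.1 ≤
        3 * ((∑' t, β.toNNReal ^ (t + N) * K (t + N + 1) : ℝ≥0) *
          paramWeight D g n m' d' p.1 p.2) := by
      rw [ENNReal.coe_tsum hsN, ← ENNReal.tsum_mul_right]
      refine mul_le_mul_right (ENNReal.tsum_le_tsum fun t => ?_) _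
      rw [ENNReal.coe_mul, mul_assoc, ENNReal.coe_pow]
      exact mul_le_mul_right (hK p.2 (t + N) p.1) _
    refine (ENNReal.toReal_mono ?_ hle).trans_eq ?_
    · exact ENNReal.mul_ne_top (by norm_num)
        (ENNReal.mul_ne_top ENNReal.coe_ne_top (hcont.cont_weight.1 p))
    · rw [ENNReal.toReal_mul, ENNReal.toReal_mul, ENNReal.coe_toReal, NNReal.coe_tsum, ha]
      simp [mul_assoc]
  have hlim : TendstoLocallyUniformly
      (fun N (p : Z × Θ) => (D p.2).finiteHorizonContValue β N p.1)
      (fun p => (D p.2).contValue β p.1) atTop := by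
    rw [Metric.tendstoLocallyUniformly_iff]
    intro ε hε p
    set B := (paramWeight D g n m' d' p.1 p.2).toReal + 1 with hB
    -- On the neighbourhood where `ℓ < ℓ(p) + 1`, the error is at most `a N * B`.
    refine ⟨_, hcont.cont_weight.2.continuousAt.eventually_lt_const (lt_add_one _), ?_⟩
    have hB0 : Tendsto (fun N => a N * B) atTop (𝓝 0) := by simpa using ha0.mul_const B
    filter_upwards [hB0.eventually_lt_const hε] with N hN q hq
    rw [Real.dist_eq]
    refine ((hbound N q).trans ?_).trans_lt hN
    have haN : 0 ≤ a N := mul_nonneg (by norm_num) (tsum_nonneg fun t => NNReal.coe_nonneg _)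
    exact mul_le_mul_of_nonneg_left (le_of_lt hq) haN
  exact hlim.continuous (Frequently.of_forall fun N =>
    continuous_finiteHorizonContValue_of_continuous hβ hfeller hcont hc hK
      (continuous_finiteHorizonValue hβ hfeller hcont hc hK N))

/-- Joint continuity of the continuation value in the state and the parameter. -/
theorem continuous_contValue {m d : Θ → ℝ≥0} (hβ : β ∈ Set.Ioo (0 : ℝ) 1)
    (hdrift : ParamDrift D β g n m d) (hm' : 0 < m') (hd' : 0 < d')
    (hfeller : ParamFeller D) (hcont : ParamCont D g n m' d') :
    Continuous fun p : Z × Θ => (D p.2).contValue β p.1 := by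
  -- The iterated drift bound needs `M ≥ 1`; `β M < 1` survives because `β < 1`.
  set M : ℝ≥0 := max (⨆ θ, m θ) 1 with hM
  have hm : ∀ θ, m θ ≤ M := fun θ => (le_ciSup hdrift.bdd_m θ).trans (le_max_left _ _)
  have hd : ∀ θ, d θ ≤ ⨆ θ, d θ := fun θ => le_ciSup hdrift.bdd_d θ
  have hn : ∀ θ, n θ ≤ ⨆ θ, n θ := fun θ => le_ciSup hdrift.bdd_n θ
  have hM1 : 1 ≤ M := le_max_right _ _
  have hβ1 : β.toNNReal < 1 := Real.toNNReal_lt_one.2 hβ.2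
  have hβM : β.toNNReal * M < 1 := by
    rw [hM, mul_max, mul_one]
    refine max_lt ?_ hβ1
    rw [← NNReal.coe_lt_coe, NNReal.coe_mul, Real.coe_toNNReal _ hβ.1.le]
    exact hdrift.discount
  refine continuous_contValue_of_bounds hβ hfeller hcont
    (K := fun t => 2 * momentFactor M (⨆ θ, d θ) m' d' t) (fun θ z => ?_)
    (fun θ t z => (hdrift.drift θ).totalMoment_le_weight (hn θ) (hm θ) hM1 (hd θ) hm' hd' t z)
    (summable_momentFactor hβ1 hβM _ _ _)
  refine ((hdrift.drift θ).absMoment_c_le_weight (hn θ) (hm θ) hM1 (hd θ) hm' hd' 0 z).trans ?_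
  refine mul_le_mul_left (ENNReal.coe_le_coe.2 ?_) _
  exact le_mul_of_one_le_left zero_le one_le_two

end Parametric

/-! ### Continuity of implicitly defined thresholds -/

theorem order_of_strictMono_or_strictAnti {X : Type*} [LinearOrder X] {f : X → ℝ}
    (hf : StrictMono f ∨ StrictAnti f) {a b x : X}
    (h : f a < f b ∧ f a < f x ∨ f b < f a ∧ f x < f a) : (a < b → a < x) ∧ (b < a → x < a) := by
  rcases hf with hf | hf
  · simp only [hf.lt_iff_lt] at h
    exact ⟨fun h1 => h.elim And.right fun h2 => absurd h2.1 h1.asymm,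
      fun h1 => h.elim (fun h2 => absurd h2.1 h1.asymm) And.right⟩
  · simp only [hf.lt_iff_gt] at h
    exact ⟨fun h1 => h.elim (fun h2 => absurd h2.1 h1.asymm) And.right,
      fun h1 => h.elim And.right fun h2 => absurd h2.1 h1.asymm⟩

/-- Comparing `f a q` with `f (x p) q` reveals the orientation of `f · q`, so it may vary with `q`;
comparing `f a q` with `u q` then locates `x q` relative to `a`. -/
theorem continuous_of_strictMono_or_strictAnti {X A : Type*} [LinearOrder X] [TopologicalSpace X]
    [OrderTopology X] [TopologicalSpace A] {f : X → A → ℝ} {u : A → ℝ} {x : A → X}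
    (hf : ∀ x, Continuous (f x)) (hu : Continuous u)
    (hmono : ∀ p, StrictMono (fun x => f x p) ∨ StrictAnti fun x => f x p)
    (hx : ∀ p, f (x p) p = u p) : Continuous x := by
  rw [continuous_iff_continuousAt]
  intro p
  have key : ∀ a ≠ x p, ∀ᶠ q in 𝓝 p, (a < x p → a < x q) ∧ (x p < a → x q < a) := by
    intro a ha
    have hinj : Function.Injective fun x => f x p :=
      (hmono p).elim StrictMono.injective StrictAnti.injective
    have hfa := (hf a).tendsto p
    have hfx := (hf (x p)).tendsto p
    have hup := hu.tendsto p
    rw [← hx p] at hup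
    have hev : ∀ᶠ q in 𝓝 p, f a q < f (x p) q ∧ f a q < u q ∨ f (x p) q < f a q ∧ u q < f a q := by
      rcases lt_or_gt_of_ne (hinj.ne ha) with h | h
      · filter_upwards [hfa.eventually_lt hfx h, hfa.eventually_lt hup h] with q h1 h2
        exact Or.inl ⟨h1, h2⟩
      · filter_upwards [hfx.eventually_lt hfa h, hup.eventually_lt hfa h] with q h1 h2
        exact Or.inr ⟨h1, h2⟩
    filter_upwards [hev] with q hq
    rw [← hx q] at hq
    exact order_of_strictMono_or_strictAnti (hmono q) hq
  exact tendsto_order.2 ⟨fun a ha => (key a ha.ne).mono fun q hq => hq.1 ha,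
    fun a ha => (key a ha.ne').mono fun q hq => hq.2 ha⟩

end

theorem mainTheorem9 {q k : ℕ}
    (X : Set ℝ) (hX : Convex ℝ X)
    (Y : Set (EuclideanSpace ℝ (Fin q))) (hY : Convex ℝ Y)
    (Θ : Set (EuclideanSpace ℝ (Fin k)))
    (β : ℝ) (hβ : β ∈ Set.Ioo (0 : ℝ) 1)
    (T : Θ → ThresholdProblem X Y)
    (g : Θ → (X × Y) → ℝ≥0) (n : Θ → ℕ) (m d : Θ → ℝ≥0) (m' d' : ℝ≥0)
    (hdrift : ParamDrift (fun θ => (T θ).toStopping) β g n m d)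
    (hconst : WeightConstants β (⨆ θ, m θ) (⨆ θ, d θ) m' d')
    (hfeller : ParamFeller fun θ => (T θ).toStopping)
    (hcont : ParamCont (fun θ => (T θ).toStopping) g n m' d')
    (hres : ∀ θ, (T θ).HasReservation β) :
    (∃! xbar : Θ → Y → X, ∀ θ, (T θ).IsDecisionThreshold β (xbar θ)) ∧
    ∀ xbar : Θ → Y → X, (∀ θ, (T θ).IsDecisionThreshold β (xbar θ)) →
      Continuous fun p : Y × Θ => xbar p.2 p.1 :=
by
  have hmono : ∀ p : Y × Θ, StrictMono (fun x => (T p.2).r (x, p.1)) ∨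
      StrictAnti fun x => (T p.2).r (x, p.1) := fun p =>
    (hres p.2).strict.imp (fun h => h p.1) fun h => h p.1
  refine ⟨?_, fun xbar hxbar => ?_⟩
  · choose xbar hxbar using fun θ => (hres θ).exists_indifferent
    refine ⟨xbar, hxbar, fun x' hx' => ?_⟩
    ext θ y : 2
    have hinj : Function.Injective fun x => (T θ).r (x, y) :=
      (hmono (y, θ)).elim StrictMono.injective StrictAnti.injective
    exact hinj ((hx' θ y).trans (hxbar θ y).symm)
  -- Convexity makes the subspace topology on `X` its order topology.
  · have := hX.ordConnected
    have hψ : Continuous fun p : Y × Θ => (T p.2).contValue β p.1 := by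
      -- `ψ*` ignores the threshold state, so any fixed point of `X` can be inserted; a pair `(y,
      -- θ)` supplies one through `xbar`.
      rcases isEmpty_or_nonempty (Y × Θ) with h | ⟨⟨p⟩⟩
      · exact continuous_of_discreteTopology
      have hc := continuous_contValue hβ hdrift hconst.pos_m' hconst.pos_d' hfeller hcont
      exact hc.comp (f := fun q : Y × Θ => ((xbar p.2 p.1, q.1), q.2)) (by fun_prop)
    refine continuous_of_strictMono_or_strictAnti (f := fun x (p : Y × Θ) => (T p.2).r (x, p.1))
      (fun x => ?_) hψ hmono fun p => hxbar p.2 p.1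
    exact hcont.cont_r.comp (f := fun q : Y × Θ => ((x, q.1), q.2)) (by fun_prop)
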